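/- All manifolds are real, finite-dimensional, smooth ($C^\infty$), Hausdorff and second countable. Let $G$ be a Lie group, $\pi:P\to X$ a smooth principal bundle with structure group $G$ acting on $P$ on the right, and $H\subset G$ a closed subgroup. Then $H$ has a Lie group structure for which it is an embedded submanifold of $G$; equip $H$ with such a structure. Let $V$ be a manifold with a smooth left action of $H$. For a principal bundle $Q\to B$ with structure group $K$ and a manifold $F$ with a smooth left action of $K$, the $Q$-associated bundle with typical fiber $F$ is the quotient space $(Q\times F)/K$, $(q,f)/K=(qk,k^{-1}f)/K$, with projection to $B$ induced by $Q\to B$ and with the smooth structure for which every smooth local section $z$ of $Q$ over an open set $U\subset B$ gives a smooth local trivialization $(z(b),f)/K\mapsto(b,f)$ over $U$. Then the quotients $\Sigma=P/H$ and $G/H$ are manifolds for which $P\to\Sigma$ and $G\to G/H$ are smooth principal $H$-bundles and the induced projection $\Sigma\to X$ is smooth, and the associated bundles $Y=(P\times V)/H\to\Sigma$ and $W=(G\times V)/H\to G/H$ with typical fiber $V$ exist as manifolds. The rule $$g':(g,v)/H\mapsto(g'g,v)/H,\qquad g',g\in G,\ v\in V,$$ defines a smooth left action of $G$ on $W$ (the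 induced representation), the $P$-associated bundle $(P\times W)/G\to X$ with typical fiber $W$ exists as a manifold, and the composite bundle $Y\to\Sigma\to X$ is isomorphic to it: there is a diffeomorphism $$\Phi:(P\times W)/G\to Y,\qquad \Phi\bigl((p,(g,v)/H)/G\bigr)=(pg,v)/H,$$ over $X$. Thus $Y\to X$ is a $P$-associated bundle with structure group $G$ and typical fiber $W$. -/

import Mathlib

open scoped Manifold ContDiff RightActions

namespace HiggsBundle

/-- The conditions, besides being locally modelled on `ℝ ^ d`, that make `M` a smooth
`d`-dimensional manifold: smooth transition maps, Hausdorff, second countable. -/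
structure IsSmoothMfd (d : ℕ) (M : Type*) [TopologicalSpace M]
    [ChartedSpace (EuclideanSpace ℝ (Fin d)) M] : Prop where
  isManifold : IsManifold (𝓡 d) ∞ M
  t2 : T2Space M
  secondCountable : SecondCountableTopology M

/-- A local trivialization that is a diffeomorphism between (open subsets of) manifolds. -/
structure IsSmoothTriv {dY dB dF : ℕ} {Y B F : Type*}
    [TopologicalSpace Y] [ChartedSpace (EuclideanSpace ℝ (Fin dY)) Y]
    [TopologicalSpace B] [ChartedSpace (EuclideanSpace ℝ (Fin dB)) B]
    [TopologicalSpace F] [ChartedSpace (EuclideanSpace ℝ (Fin dF)) F]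
    {ϖ : Y → B} (e : Bundle.Trivialization F ϖ) : Prop where
  smooth : ContMDiffOn (𝓡 dY) ((𝓡 dB).prod (𝓡 dF)) ∞ e e.source
  smooth_symm : ContMDiffOn ((𝓡 dB).prod (𝓡 dF)) (𝓡 dY) ∞
    e.toOpenPartialHomeomorph.symm e.target

/-- `π : P → B` is a smooth principal bundle whose structure group `K` acts on `P` on the right
(a right action is an action of the opposite group, and `p <• g` stands for `p g`).
The equivariant local trivializations force the action to be free and transitive on fibres, and
`π` to be a surjective submersion. -/
structure IsPrincipalBundle {dK dP dB : ℕ} (K : Type*) {P B : Type*} [Group K]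
    [TopologicalSpace K] [ChartedSpace (EuclideanSpace ℝ (Fin dK)) K]
    [TopologicalSpace P] [ChartedSpace (EuclideanSpace ℝ (Fin dP)) P]
    [TopologicalSpace B] [ChartedSpace (EuclideanSpace ℝ (Fin dB)) B]
    [MulAction Kᵐᵒᵖ P] (π : P → B) : Prop where
  smooth_act : ContMDiff ((𝓡 dP).prod (𝓡 dK)) (𝓡 dP) ∞ (fun q : P × K => q.1 <• q.2)
  proj_act : ∀ (p : P) (g : K), π (p <• g) = π p
  local_triv : ∀ b : B, ∃ e : Bundle.Trivialization K π, b ∈ e.baseSet ∧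
    IsSmoothTriv (dY := dP) (dB := dB) (dF := dK) e ∧
    ∀ p ∈ e.source, ∀ g : K, e (p <• g) = ((e p).1, (e p).2 * g)

section Associated

variable (K P F : Type*) [Group K] [MulAction Kᵐᵒᵖ P] [MulAction K F]

/-- The relation `(p, v) ∼ (p g, g⁻¹ v)` on `P × F`. -/
def assocSetoid : Setoid (P × F) where
  r a b := ∃ g : K, b = (a.1 <• g, g⁻¹ • a.2)
  iseqv :=
    { refl := fun a => ⟨1, by simp⟩
      symm := by
        rintro a b ⟨g, rfl⟩
        exact ⟨g⁻¹, by simp [smul_smul]⟩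
      trans := by
        rintro a b c ⟨g, rfl⟩ ⟨g', rfl⟩
        exact ⟨g * g', by simp [smul_smul]⟩ }

/-- The quotient `(P × F) / K`. -/
def Assoc : Type _ := Quotient (assocSetoid K P F)

variable {P F}

/-- The class `(p, v) / K`. -/
def Assoc.mk (p : P) (v : F) : Assoc K P F := Quotient.mk (assocSetoid K P F) (p, v)

/-- The quotient topology. -/
instance [TopologicalSpace P] [TopologicalSpace F] : TopologicalSpace (Assoc K P F) :=
  inferInstanceAs (TopologicalSpace (Quotient (assocSetoid K P F)))

variable {K}

/-- The projection `(p, v) / K ↦ π p`. -/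
def Assoc.proj {B : Type*} (π : P → B) (hπ : ∀ (p : P) (g : K), π (p <• g) = π p) :
    Assoc K P F → B :=
  Quotient.lift (fun a : P × F => π a.1) (by rintro a b ⟨g, rfl⟩; exact (hπ a.1 g).symm)

end Associated

/-- The given smooth structure on `(P × F) / K` is the one of the bundle with typical fibre `F`
associated to the principal bundle `π : P → B`: it is a manifold, and every smooth local section
`z` of `P`, defined over an open set `U`, gives a smooth trivialization
`(z x, v) / K ↦ (x, v)` over `U`. -/
structure IsAssociatedBundle {dP dB dF dY : ℕ} {K P B : Type*} (F : Type*) [Group K]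
    [TopologicalSpace P] [ChartedSpace (EuclideanSpace ℝ (Fin dP)) P]
    [TopologicalSpace B] [ChartedSpace (EuclideanSpace ℝ (Fin dB)) B]
    [TopologicalSpace F] [ChartedSpace (EuclideanSpace ℝ (Fin dF)) F]
    [MulAction Kᵐᵒᵖ P] [MulAction K F]
    [ChartedSpace (EuclideanSpace ℝ (Fin dY)) (Assoc K P F)]
    (π : P → B) (hπ : ∀ (p : P) (g : K), π (p <• g) = π p) : Prop where
  mfd : IsSmoothMfd dY (Assoc K P F)
  triv : ∀ (U : Set B) (z : B → P), IsOpen U → ContMDiffOn (𝓡 dB) (𝓡 dP) ∞ z U →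
    (∀ x ∈ U, π (z x) = x) →
    ∃ e : Bundle.Trivialization F (Assoc.proj (F := F) π hπ), e.baseSet = U ∧
      IsSmoothTriv (dY := dY) (dB := dB) (dF := dF) e ∧
      ∀ x ∈ U, ∀ v : F, e (Assoc.mk K (z x) v) = (x, v)

section Subgroup

variable {G : Type*} [Group G] (H : Subgroup G)

/-- The restriction of a right action of `G` to the subgroup `H`. -/
instance restrictRightAction {P : Type*} [MulAction Gᵐᵒᵖ P] : MulAction (↥H)ᵐᵒᵖ P :=
  MulAction.compHom P (MonoidHom.op H.subtype)

variable (P : Type*) [MulAction Gᵐᵒᵖ P]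

/-- The quotient `Σ = P / H` of `P` by the right action of `H` (with the quotient topology). -/
abbrev Sig : Type _ := MulAction.orbitRel.Quotient (↥H)ᵐᵒᵖ P

variable {P}

/-- The projection `P → P / H`. -/
def toSig (p : P) : Sig H P := Quotient.mk _ p

theorem toSig_act (p : P) (h : H) : toSig H (p <• h) = toSig H p :=
  MulAction.orbitRel.Quotient.quotient_smul_eq

theorem coset_act (g : G) (h : H) : (QuotientGroup.mk (g <• h) : G ⧸ H) = QuotientGroup.mk g :=
  QuotientGroup.mk_mul_of_mem g h.2

/-- The projection `P / H → X` induced by a `G`-invariant map `π : P → X`. -/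
def sigProj {X : Type*} (π : P → X) (hπ : ∀ (p : P) (g : G), π (p <• g) = π p) : Sig H P → X :=
  Quotient.lift π (by rintro a b ⟨h, rfl⟩; exact hπ b (h.unop : G))

/-- The induced representation: `G` acts on `W = (G × V) / H` by
`g' ((g, v) / H) = (g' g, v) / H`. -/
instance inducedAction {V : Type*} [MulAction H V] : MulAction G (Assoc H G V) where
  smul g' := Quotient.map' (s₁ := assocSetoid H G V) (s₂ := assocSetoid H G V)
    (fun a => (g' * a.1, a.2)) (by
      rintro a b ⟨h, rfl⟩
      exact ⟨h, Prod.ext (mul_assoc g' a.1 (h : G)).symm rfl⟩)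
  one_smul := by
    rintro ⟨a⟩
    exact congrArg (Quotient.mk (assocSetoid H G V)) (Prod.ext (one_mul a.1) rfl)
  mul_smul g g' := by
    rintro ⟨a⟩
    exact congrArg (Quotient.mk (assocSetoid H G V)) (Prod.ext (mul_assoc g g' a.1) rfl)

/-- The given charts make `H` a Lie group that is an embedded submanifold of the Lie group `G`. -/
structure IsEmbeddedLieSubgroup {dG : ℕ} (dH : ℕ) [TopologicalSpace G]
    [ChartedSpace (EuclideanSpace ℝ (Fin dG)) G]
    [ChartedSpace (EuclideanSpace ℝ (Fin dH)) H] : Prop where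
  lieGroup : LieGroup (𝓡 dH) ∞ H
  embedding : Manifold.IsSmoothEmbedding (𝓡 dH) (𝓡 dG) ∞ (Subtype.val : H → G)

end Subgroup

end HiggsBundle

/-! The rule for `Φ` is a well-defined bijection by pure algebra, with inverse `(p, v)/H ↦ (p, (1,
v)/H)/G`. The remaining content is differential: five quotients need manifold structures whose
quotient maps are smooth and have smooth local sections (`IsSmoothQuotient`). Granted these, a map
out of a quotient is smooth as soon as its composite with the quotient map is, so smoothness of `Φ`,
of its inverse and of the induced action is read off from explicit formulas upstairs.

The closed subgroup theorem is proved without the exponential map. In a chart centred at `1`, `H`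
becomes a locally closed local subgroup `S` of a Euclidean space whose product is `x + y` up to an
error of order `‖x‖ ‖y‖`. The directions in which `S` approaches `0` form a linear subspace: powers
of small elements fill whole directions, products give sums, inverses give negatives. The projection
`p` to this tangent space is, near `0`, a bijection from `S` to a neighbourhood of `0`. It is onto
because a point of a compact piece of `S` whose projection is nearest to the goal could be improved
by multiplying it with an element that approximates the defect; it is injective because quotients of
elements of `S` are again in `S`, hence nearly tangent. The inverse satisfies a first-order equation
`g' = Ψ ∘ g` with smooth `Ψ`, so it is smooth (`IsLocalSubgroup.exists_graph`). Straightening its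
graph gives an adapted chart at `1`, and left translation gives an atlas of `H`.

For `G ⧸ H`, the inverse function theorem applied to `(h, b) ↦ σ b * h` gives a slice `σ`
transversal to `H`; embeddedness allows shrinking it until it meets each coset at most once, and its
translates are charts (`exists_saturated_product`). Local triviality of `P` carries over the rest:
`P / H` is locally `X × G ⧸ H`, and `(P × F) / K` is locally `B × F`. -/

namespace HiggsBundle

open Set Filter Topology Metric

/-! ### Local subgroups of a normed space and their tangent spaces -/

section LocalSubgroup

variable {E : Type*} [NormedAddCommGroup E] [NormedSpace ℝ E]

/-- A smooth local group law `m` on the ball of radius `r`, with division `δ`, together with a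
locally closed local subgroup `S`. -/
structure IsLocalSubgroup (r : ℝ) (m δ : E × E → E) (S : Set E) : Prop where
  pos : 0 < r
  smooth : ContDiffOn ℝ ∞ m (ball 0 r ×ˢ ball 0 r)
  zero_left : ∀ y ∈ ball (0 : E) r, m (0, y) = y
  zero_right : ∀ x ∈ ball (0 : E) r, m (x, 0) = x
  zero_mem : (0 : E) ∈ S
  mul_mem : ∀ x ∈ S, ∀ y ∈ S, x ∈ ball (0 : E) r → y ∈ ball (0 : E) r → m (x, y) ∈ S
  div_mem : ∀ x ∈ S, ∀ y ∈ S, x ∈ ball (0 : E) r → y ∈ ball (0 : E) r → δ (x, y) ∈ S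
  mul_div : ∀ x ∈ ball (0 : E) r, ∀ y ∈ ball (0 : E) r, m (x, δ (x, y)) = y
  div_continuousAt : ContinuousAt δ (0, 0)
  div_zero : δ (0, 0) = 0
  closed : IsClosed (S ∩ closedBall 0 r)

/-- The vectors `v` such that `S` comes `o(s)`-close to `s • v` as `s` decreases to zero. -/
def tangentSet (S : Set E) : Set E :=
  {v | ∀ ε > 0, ∀ᶠ s in 𝓝[>] (0 : ℝ), ∃ h ∈ S, ‖h - s • v‖ ≤ ε * s}

variable {r : ℝ} {m δ : E × E → E} {S : Set E}

theorem IsLocalSubgroup.contDiffAt (hS : IsLocalSubgroup r m δ S) {x y : E}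
    (hx : x ∈ ball (0 : E) r) (hy : y ∈ ball (0 : E) r) : ContDiffAt ℝ ∞ m (x, y) :=
  hS.smooth.contDiffAt ((isOpen_ball.prod isOpen_ball).mem_nhds ⟨hx, hy⟩)

/-- The derivative of `y ↦ m (x, y)` at `y`. -/
noncomputable def rightDeriv (m : E × E → E) (z : E × E) : E →L[ℝ] E :=
  (fderiv ℝ m z).comp (ContinuousLinearMap.inr ℝ E E)

theorem IsLocalSubgroup.hasFDerivAt_right (hS : IsLocalSubgroup r m δ S) {x y : E}
    (hx : x ∈ ball (0 : E) r) (hy : y ∈ ball (0 : E) r) :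
    HasFDerivAt (fun y => m (x, y)) (rightDeriv m (x, y)) y :=
  ((hS.contDiffAt hx hy).differentiableAt (by simp)).hasFDerivAt.comp y
    (hasFDerivAt_prodMk_right x y)

theorem IsLocalSubgroup.rightDeriv_zero (hS : IsLocalSubgroup r m δ S) {y : E}
    (hy : y ∈ ball (0 : E) r) : rightDeriv m (0, y) = ContinuousLinearMap.id ℝ E := by
  have h1 := hS.hasFDerivAt_right (mem_ball_self hS.pos) hy
  refine h1.unique ((hasFDerivAt_id y).congr_of_eventuallyEq ?_)
  filter_upwards [isOpen_ball.mem_nhds hy] with z hz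
  exact hS.zero_left z hz

theorem IsLocalSubgroup.contDiffAt_rightDeriv (hS : IsLocalSubgroup r m δ S) {x y : E}
    (hx : x ∈ ball (0 : E) r) (hy : y ∈ ball (0 : E) r) :
    ContDiffAt ℝ ∞ (rightDeriv m) (x, y) :=
  ((hS.contDiffAt hx hy).fderiv_right (m := ∞) (by simp)).clm_comp contDiffAt_const

/-- The derivative of `y ↦ m (x, y)` is the identity at `x = 0` and depends on `x` in a Lipschitz
way, so `y ↦ m (x, y) - y` has derivative at most `C * ‖x‖`; the mean value inequality on a ball
concludes. -/
theorem IsLocalSubgroup.exists_estimate (hS : IsLocalSubgroup r m δ S) :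
    ∃ ρ > 0, ρ ≤ r ∧ ∃ C > 0, ∀ x ∈ ball (0 : E) ρ, ∀ y ∈ ball (0 : E) ρ, ∀ y' ∈ ball (0 : E) ρ,
      ‖m (x, y) - m (x, y') - (y - y')‖ ≤ C * ‖x‖ * ‖y - y'‖ := by
  have h0 := mem_ball_self (x := (0 : E)) hS.pos
  obtain ⟨K, t, ht, hK⟩ := ((hS.contDiffAt_rightDeriv h0 h0).of_le
    (m := 1) (by simp)).exists_lipschitzOnWith
  obtain ⟨ε, hε, hεt⟩ := Metric.mem_nhds_iff.1 ht
  refine ⟨min ε r, lt_min hε hS.pos, min_le_right _ _, K + 1, by positivity, ?_⟩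
  intro x hx y hy y' hy'
  have sub : ball (0 : E) (min ε r) ⊆ ball 0 r := ball_subset_ball (min_le_right _ _)
  have sub' : ∀ u ∈ ball (0 : E) (min ε r), ∀ w ∈ ball (0 : E) (min ε r), (u, w) ∈ t := by
    intro u hu w hw
    apply hεt
    rw [mem_ball_zero_iff] at hu hw
    rw [show ((0 : E), (0 : E)) = 0 from rfl, mem_ball_zero_iff, Prod.norm_def]
    exact max_lt (hu.trans_le (min_le_left _ _)) (hw.trans_le (min_le_left _ _))
  have key := (convex_ball (0 : E) (min ε r)).norm_image_sub_le_of_norm_hasFDerivWithin_le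
    (f := fun y => m (x, y) - y)
    (f' := fun y => rightDeriv m (x, y) - ContinuousLinearMap.id ℝ E) (C := (K + 1) * ‖x‖)
    (fun w hw => ((hS.hasFDerivAt_right (sub hx) (sub hw)).sub (hasFDerivAt_id w)).hasFDerivWithinAt)
    (fun w hw => by
      have := hK.dist_le_mul _ (sub' x hx w hw) _ (sub' 0 (mem_ball_self (lt_min hε hS.pos)) w hw)
      rw [hS.rightDeriv_zero (sub hw), dist_eq_norm, dist_eq_norm] at this
      refine this.trans ?_
      have : ‖(x, w) - (0, w)‖ = ‖x‖ := by simp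
      rw [this]
      nlinarith [norm_nonneg x]) hy' hy
  convert key using 2
  abel

variable {ρ C : ℝ}

/-- Approximate additivity of a product near the identity. -/
def NearlyAdditive (m : E × E → E) (ρ C : ℝ) : Prop :=
  ∀ x ∈ ball (0 : E) ρ, ∀ y ∈ ball (0 : E) ρ, ∀ y' ∈ ball (0 : E) ρ,
      ‖m (x, y) - m (x, y') - (y - y')‖ ≤ C * ‖x‖ * ‖y - y'‖

theorem IsLocalSubgroup.norm_mul_sub_le (hS : IsLocalSubgroup r m δ S) (hρ : 0 < ρ) (hρr : ρ ≤ r)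
    (hC : NearlyAdditive m ρ C) {x y : E} (hx : x ∈ ball (0 : E) ρ) (hy : y ∈ ball (0 : E) ρ) :
    ‖m (x, y) - x - y‖ ≤ C * ‖x‖ * ‖y‖ := by
  have := hC x hx y hy 0 (mem_ball_self hρ)
  rwa [hS.zero_right x (ball_subset_ball hρr hx), sub_zero] at this

/-- The element is the `n`-th power of `x`. Under the two size hypotheses the powers stay in the
ball with norm at most `2 * (n * ‖x‖)`, so one further factor costs at most `2 * C * n * ‖x‖ ^ 2`;
these errors add up to less than `C * (n * ‖x‖) ^ 2`. -/
theorem IsLocalSubgroup.exists_pow (hS : IsLocalSubgroup r m δ S) (hρ : 0 < ρ) (hρr : ρ ≤ r)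
    (hC0 : 0 < C) (hC : NearlyAdditive m ρ C) {x : E} (hx : x ∈ S) (n : ℕ)
    (h1 : C * (n * ‖x‖) ≤ 1) (h2 : 2 * (n * ‖x‖) < ρ) :
    ∃ y ∈ S, ‖y - (n : ℝ) • x‖ ≤ C * (n * ‖x‖) ^ 2 := by
  induction n with
  | zero => exact ⟨0, hS.zero_mem, by simp⟩
  | succ n ih =>
    push_cast at h1 h2
    have hx0 := norm_nonneg x
    have hn0 : 0 ≤ n * ‖x‖ := by positivity
    obtain ⟨y, hy, hyn⟩ := ih (by nlinarith) (by nlinarith)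
    have hyx : ‖y‖ ≤ 2 * (n * ‖x‖) := by
      have : ‖y‖ ≤ ‖y - (n : ℝ) • x‖ + ‖(n : ℝ) • x‖ := by
        simpa using norm_add_le (y - (n : ℝ) • x) ((n : ℝ) • x)
      rw [norm_smul, Real.norm_natCast] at this
      have hCn : C * (n * ‖x‖) ≤ 1 := by nlinarith
      nlinarith [mul_le_mul_of_nonneg_right hCn hn0]
    have hyb : y ∈ ball (0 : E) ρ := by rw [mem_ball_zero_iff]; nlinarith
    have hxb : x ∈ ball (0 : E) ρ := by rw [mem_ball_zero_iff]; nlinarith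
    refine ⟨m (y, x), hS.mul_mem y hy x hx (ball_subset_ball hρr hyb) (ball_subset_ball hρr hxb), ?_⟩
    have e1 := hS.norm_mul_sub_le hρ hρr hC hyb hxb
    have e2 : m (y, x) - ((n + 1 : ℕ) : ℝ) • x = (m (y, x) - y - x) + (y - (n : ℝ) • x) := by
      push_cast; module
    rw [e2]
    refine (norm_add_le _ _).trans ?_
    push_cast
    have : C * ‖y‖ * ‖x‖ ≤ C * (2 * (n * ‖x‖)) * ‖x‖ := by gcongr
    nlinarith [mul_nonneg hC0.le (sq_nonneg ‖x‖)]

/-- Limits of directions of points of `S` tending to zero are tangent vectors. -/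
theorem IsLocalSubgroup.mem_tangentSet (hS : IsLocalSubgroup r m δ S) {u : ℕ → E} {v : E}
    (hu : ∀ n, u n ∈ S) (hu0 : ∀ n, u n ≠ 0) (hlim : Tendsto u atTop (𝓝 0))
    (hv : Tendsto (fun n => ‖u n‖⁻¹ • u n) atTop (𝓝 v)) : v ∈ tangentSet S := by
  obtain ⟨ρ, hρ, hρr, C, hC0, hC⟩ := hS.exists_estimate
  intro ε hε
  have hs : ∀ᶠ s in 𝓝[>] (0 : ℝ), s < min (min (1 / C) (ρ / 2)) (ε / (3 * C)) :=
    nhdsWithin_le_nhds (Iio_mem_nhds (by positivity))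
  filter_upwards [hs, self_mem_nhdsWithin] with s hs hs0
  rw [mem_Ioi] at hs0
  rw [lt_min_iff, lt_min_iff, lt_div_iff₀ hC0, lt_div_iff₀ (by norm_num),
    lt_div_iff₀ (by positivity)] at hs
  obtain ⟨⟨hs1, hs2⟩, hs3⟩ := hs
  have e1 : ∀ᶠ n in atTop, ‖u n‖ < ε * s / 3 :=
    (tendsto_zero_iff_norm_tendsto_zero.1 hlim).eventually (Iio_mem_nhds (by positivity))
  have e2 : ∀ᶠ n in atTop, ‖‖u n‖⁻¹ • u n - v‖ < ε / 3 :=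
    (tendsto_iff_norm_sub_tendsto_zero.1 hv).eventually (Iio_mem_nhds (by positivity))
  obtain ⟨n, hn1, hn2⟩ := (e1.and e2).exists
  have hpos : 0 < ‖u n‖ := norm_pos_iff.2 (hu0 n)
  -- Once `u n` is much shorter than `s`, about `s / ‖u n‖` factors of it reach length `s` in its
  -- direction. The three errors are that of the power (`C * s ^ 2`), the rounding (`‖u n‖`) and
  -- that of the direction; each is at most `ε * s / 3`.
  set k := ⌊s / ‖u n‖⌋₊ with hk
  have hk1 : k * ‖u n‖ ≤ s := by
    rw [← le_div_iff₀ hpos]; exact Nat.floor_le (by positivity)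
  have hk2 : s < k * ‖u n‖ + ‖u n‖ := by
    have := Nat.lt_floor_add_one (s / ‖u n‖)
    rw [div_lt_iff₀ hpos] at this
    linarith
  obtain ⟨y, hy, hyk⟩ := hS.exists_pow hρ hρr hC0 hC (hu n) k (by nlinarith) (by nlinarith)
  refine ⟨y, hy, ?_⟩
  have e3 : y - s • v = (y - (k : ℝ) • u n) + (k * ‖u n‖ - s) • (‖u n‖⁻¹ • u n)
      + s • (‖u n‖⁻¹ • u n - v) := by
    have : ((k : ℝ) * ‖u n‖) • (‖u n‖⁻¹ • u n) = (k : ℝ) • u n := by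
      rw [smul_smul, mul_assoc, mul_inv_cancel₀ hpos.ne', mul_one]
    rw [sub_smul, this, smul_sub]
    abel
  have e4 : ‖(k * ‖u n‖ - s) • (‖u n‖⁻¹ • u n)‖ ≤ ‖u n‖ := by
    rw [norm_smul, norm_smul, norm_inv, norm_norm, inv_mul_cancel₀ hpos.ne', mul_one,
      Real.norm_eq_abs, abs_le]
    constructor <;> linarith
  have e5 : ‖s • (‖u n‖⁻¹ • u n - v)‖ ≤ s * (ε / 3) := by
    rw [norm_smul, Real.norm_of_nonneg hs0.le]; gcongr
  rw [e3]
  refine (norm_add₃_le).trans ?_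
  have hk0 : 0 ≤ k * ‖u n‖ := by positivity
  have e6 : C * (k * ‖u n‖) ^ 2 ≤ C * s ^ 2 := by gcongr
  nlinarith

/-- If `h` and `k` in `S` approximate `s • v` and `s • w`, then `m (h, k)` approximates `s • (v +
w)`, the defect of additivity being of order `s ^ 2`. -/
theorem IsLocalSubgroup.add_mem_tangentSet (hS : IsLocalSubgroup r m δ S) {v w : E}
    (hv : v ∈ tangentSet S) (hw : w ∈ tangentSet S) : v + w ∈ tangentSet S := by
  obtain ⟨ρ, hρ, hρr, C, hC0, hC⟩ := hS.exists_estimate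
  intro ε hε
  set M := (‖v‖ + 1) * (‖w‖ + 1) with hM
  have hM0 : 0 < M := by positivity
  set L := ‖v‖ + ‖w‖ + 1 with hL
  have hL0 : 0 < L := by positivity
  have hs : ∀ᶠ s in 𝓝[>] (0 : ℝ), s < min (ρ / L) (ε / (3 * C * M)) :=
    nhdsWithin_le_nhds (Iio_mem_nhds (by positivity))
  have hε' : 0 < min (ε / 3) 1 := by positivity
  filter_upwards [hs, self_mem_nhdsWithin, hv _ hε', hw _ hε'] with s hs hs0 ⟨h, hh, hhv⟩ ⟨k, hk, hkw⟩
  rw [mem_Ioi] at hs0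
  rw [lt_min_iff, lt_div_iff₀ hL0, lt_div_iff₀ (by positivity)] at hs
  obtain ⟨hs1, hs2⟩ := hs
  have hb : ∀ {h v : E}, ‖h - s • v‖ ≤ min (ε / 3) 1 * s → ‖h‖ ≤ s * (‖v‖ + 1) := by
    intro h v hv
    have : ‖h‖ ≤ ‖h - s • v‖ + ‖s • v‖ := by simpa using norm_add_le (h - s • v) (s • v)
    rw [norm_smul, Real.norm_of_nonneg hs0.le] at this
    nlinarith [min_le_right (ε / 3) 1]
  have hh1 := hb hhv
  have hk1 := hb hkw
  have hhb : h ∈ ball (0 : E) ρ := by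
    rw [mem_ball_zero_iff]; nlinarith [norm_nonneg v, norm_nonneg w]
  have hkb : k ∈ ball (0 : E) ρ := by
    rw [mem_ball_zero_iff]; nlinarith [norm_nonneg v, norm_nonneg w]
  refine ⟨m (h, k), hS.mul_mem h hh k hk (ball_subset_ball hρr hhb) (ball_subset_ball hρr hkb), ?_⟩
  have e1 := hS.norm_mul_sub_le hρ hρr hC hhb hkb
  have e2 : m (h, k) - s • (v + w) = (m (h, k) - h - k) + (h - s • v) + (k - s • w) := by module
  rw [e2]
  refine (norm_add₃_le).trans ?_
  have e3 : C * ‖h‖ * ‖k‖ ≤ C * (s * (‖v‖ + 1)) * (s * (‖w‖ + 1)) := by gcongr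
  have e4 : C * (s * (‖v‖ + 1)) * (s * (‖w‖ + 1)) = C * M * s * s := by rw [hM]; ring
  have e5 : min (ε / 3) 1 * s ≤ ε / 3 * s := by gcongr; exact min_le_left _ _
  nlinarith

theorem smul_mem_tangentSet {v : E} {c : ℝ} (hc : 0 < c)
    (hv : v ∈ tangentSet S) : c • v ∈ tangentSet S := by
  intro ε hε
  have ht : Tendsto (fun s : ℝ => s * c) (𝓝[>] 0) (𝓝[>] 0) := by
    refine tendsto_nhdsWithin_iff.2 ⟨?_, ?_⟩
    · have : Tendsto (fun s : ℝ => s * c) (𝓝 0) (𝓝 (0 * c)) := (continuous_mul_const c).tendsto 0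
      rw [zero_mul] at this
      exact this.mono_left nhdsWithin_le_nhds
    · filter_upwards [self_mem_nhdsWithin] with s hs
      exact mul_pos hs hc
  filter_upwards [ht.eventually (hv (ε / c) (by positivity))] with s ⟨h, hh, hs⟩
  refine ⟨h, hh, ?_⟩
  rw [smul_smul]
  refine hs.trans (le_of_eq ?_)
  field_simp

/-- In a small ball, quotients are controlled by differences. -/
theorem IsLocalSubgroup.exists_div_estimate (hS : IsLocalSubgroup r m δ S) :
    ∃ ρ > 0, ρ ≤ r ∧ ∃ C > 0, NearlyAdditive m ρ C ∧ ∃ η > 0, η ≤ ρ ∧ C * η ≤ 1 / 4 ∧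
      ∀ x ∈ ball (0 : E) η, ∀ y ∈ ball (0 : E) η, δ (x, y) ∈ ball (0 : E) ρ ∧
        ‖y - x - δ (x, y)‖ ≤ C * ‖x‖ * ‖δ (x, y)‖ ∧ ‖δ (x, y)‖ ≤ 2 * ‖y - x‖ ∧
        ‖y - x‖ ≤ 2 * ‖δ (x, y)‖ := by
  obtain ⟨ρ, hρ, hρr, C, hC0, hC⟩ := hS.exists_estimate
  have h1 : δ ⁻¹' ball (0 : E) ρ ∈ 𝓝 ((0 : E), (0 : E)) := hS.div_continuousAt (by
    rw [hS.div_zero]; exact ball_mem_nhds _ hρ)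
  obtain ⟨η, hη, hηδ⟩ := Metric.mem_nhds_iff.1 h1
  refine ⟨ρ, hρ, hρr, C, hC0, hC, min (min η ρ) (1 / (4 * C)), by positivity,
    (min_le_left _ _).trans (min_le_right _ _), ?_, ?_⟩
  · calc C * _ ≤ C * (1 / (4 * C)) := by gcongr; exact min_le_right _ _
      _ = 1 / 4 := by field_simp
  intro x hx y hy
  rw [mem_ball_zero_iff, lt_min_iff, lt_min_iff] at hx hy
  have hd : δ (x, y) ∈ ball (0 : E) ρ := by
    apply hηδ
    rw [show ((0 : E), (0 : E)) = 0 from rfl, mem_ball_zero_iff, Prod.norm_def]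
    exact max_lt hx.1.1 hy.1.1
  have hxr : x ∈ ball (0 : E) ρ := by rw [mem_ball_zero_iff]; exact hx.1.2
  have hyr : y ∈ ball (0 : E) ρ := by rw [mem_ball_zero_iff]; exact hy.1.2
  -- Since `y = m (x, δ (x, y))`, the estimate for products becomes one for quotients. As `C * ‖x‖ ≤
  -- 1 / 4`, the norms of `y - x` and `δ (x, y)` then agree up to a factor `2`.
  have e := hS.norm_mul_sub_le hρ hρr hC hxr hd
  rw [hS.mul_div x (ball_subset_ball hρr hxr) y (ball_subset_ball hρr hyr)] at e
  have hCx : C * ‖x‖ ≤ 1 / 4 := by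
    have := hx.2.le
    rw [le_div_iff₀ (by positivity)] at this
    linarith
  have e' : C * ‖x‖ * ‖δ (x, y)‖ ≤ 1 / 4 * ‖δ (x, y)‖ := by gcongr
  have e2 : ‖δ (x, y)‖ ≤ ‖y - x‖ + ‖y - x - δ (x, y)‖ := by
    simpa using norm_sub_le (y - x) (y - x - δ (x, y))
  have e3 : ‖y - x‖ ≤ ‖y - x - δ (x, y)‖ + ‖δ (x, y)‖ := by
    simpa using norm_add_le (y - x - δ (x, y)) (δ (x, y))
  exact ⟨hd, e, by linarith [norm_nonneg (y - x)], by linarith [norm_nonneg (δ (x, y))]⟩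

/-- If `h` approximates `s • v`, its inverse `δ (h, 0)` is `-h` up to order `s ^ 2`. -/
theorem IsLocalSubgroup.neg_mem_tangentSet (hS : IsLocalSubgroup r m δ S) {v : E}
    (hv : v ∈ tangentSet S) : -v ∈ tangentSet S := by
  obtain ⟨ρ, hρ, hρr, C, hC0, hC, η, hη, hηρ, hCη, hd⟩ := hS.exists_div_estimate
  intro ε hε
  set M := ‖v‖ + 1 with hM
  have hM0 : 0 < M := by positivity
  have hs : ∀ᶠ s in 𝓝[>] (0 : ℝ), s < min (η / M) (ε / (4 * C * M ^ 2)) :=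
    nhdsWithin_le_nhds (Iio_mem_nhds (by positivity))
  have hε' : 0 < min (ε / 2) 1 := by positivity
  filter_upwards [hs, self_mem_nhdsWithin, hv _ hε'] with s hs hs0 ⟨h, hh, hhv⟩
  rw [mem_Ioi] at hs0
  rw [lt_min_iff, lt_div_iff₀ hM0, lt_div_iff₀ (by positivity)] at hs
  obtain ⟨hs1, hs2⟩ := hs
  have hh1 : ‖h‖ ≤ s * M := by
    have : ‖h‖ ≤ ‖h - s • v‖ + ‖s • v‖ := by simpa using norm_add_le (h - s • v) (s • v)
    rw [norm_smul, Real.norm_of_nonneg hs0.le] at this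
    nlinarith [min_le_right (ε / 2) 1]
  have hhb : h ∈ ball (0 : E) η := by rw [mem_ball_zero_iff]; linarith
  have h0b : (0 : E) ∈ ball (0 : E) η := mem_ball_self hη
  have sub := ball_subset_ball (x := (0 : E)) (hηρ.trans hρr)
  obtain ⟨-, d1, d2, -⟩ := hd h hhb 0 h0b
  refine ⟨δ (h, 0), hS.div_mem h hh 0 hS.zero_mem (sub hhb) (sub h0b), ?_⟩
  rw [zero_sub] at d1
  rw [zero_sub, norm_neg] at d2
  have e2 : δ (h, 0) - s • -v = -(-h - δ (h, 0)) + -(h - s • v) := by module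
  rw [e2]
  refine (norm_add_le _ _).trans ?_
  rw [norm_neg, norm_neg]
  have e3 : C * ‖h‖ * ‖δ (h, 0)‖ ≤ C * (s * M) * (2 * (s * M)) := by gcongr; linarith
  have e5 : min (ε / 2) 1 * s ≤ ε / 2 * s := by gcongr; exact min_le_left _ _
  nlinarith

/-- The tangent space at zero of a local subgroup. -/
def IsLocalSubgroup.tangent (hS : IsLocalSubgroup r m δ S) : Submodule ℝ E where
  carrier := tangentSet S
  add_mem' := hS.add_mem_tangentSet
  zero_mem' := by
    intro ε hε
    filter_upwards [self_mem_nhdsWithin] with s hs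
    exact ⟨0, hS.zero_mem, by simpa using mul_nonneg hε.le (le_of_lt hs)⟩
  smul_mem' := by
    intro c v hv
    rcases lt_trichotomy c 0 with hc | rfl | hc
    · have := hS.neg_mem_tangentSet (smul_mem_tangentSet (neg_pos.2 hc) hv)
      simpa using this
    · rw [zero_smul]
      intro ε hε
      filter_upwards [self_mem_nhdsWithin] with s hs
      exact ⟨0, hS.zero_mem, by simpa using mul_nonneg hε.le (le_of_lt hs)⟩
    · exact smul_mem_tangentSet hc hv

end LocalSubgroup

end HiggsBundle

/-! ### A local subgroup is a smooth graph over its tangent space -/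

namespace HiggsBundle

open Set Filter Topology Metric Asymptotics

/-- A solution of `g' = Ψ ∘ g` with `Ψ` smooth is smooth. -/
theorem contDiffOn_of_hasFDerivAt_comp {E F : Type*} [NormedAddCommGroup E]
    [NormedSpace ℝ E] [NormedAddCommGroup F] [NormedSpace ℝ F]
    {g : F → E} {Ψ : E → F →L[ℝ] E} {U : Set F} (hU : IsOpen U)
    (hg : ∀ a ∈ U, HasFDerivAt g (Ψ (g a)) a) (hΨ : ∀ a ∈ U, ContDiffAt ℝ ∞ Ψ (g a)) :
    ContDiffOn ℝ ∞ g U := by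
  rw [contDiffOn_infty]
  intro n
  induction n with
  | zero =>
    exact contDiffOn_zero.2 fun a ha => (hg a ha).continuousAt.continuousWithinAt
  | succ n ih =>
    push_cast
    rw [contDiffOn_succ_iff_fderiv_of_isOpen hU]
    refine ⟨fun a ha => (hg a ha).differentiableAt.differentiableWithinAt, by simp, ?_⟩
    -- Bootstrapping: if `g` is `C^n`, so is its derivative `Ψ ∘ g`.
    have : ContDiffOn ℝ n (Ψ ∘ g) U := fun a ha =>
      ((hΨ a ha).of_le (by exact_mod_cast le_top)).comp_contDiffWithinAt a (ih a ha)
    exact this.congr fun a ha => (hg a ha).fderiv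

section LocalSubgroupGraph

variable {E : Type*} [NormedAddCommGroup E] [NormedSpace ℝ E] [FiniteDimensional ℝ E]
  {r : ℝ} {m δ : E × E → E} {S : Set E}

/-- Small elements of a local subgroup are nearly tangent. -/
theorem IsLocalSubgroup.norm_sub_proj_le (hS : IsLocalSubgroup r m δ S)
    (p : E →L[ℝ] hS.tangent) (hp : ∀ v : hS.tangent, p v = v) {ε : ℝ} (hε : 0 < ε) :
    ∃ R > 0, ∀ x ∈ S, ‖x‖ < R → ‖x - p x‖ ≤ ε * ‖x‖ := by
  -- Counterexamples tending to `0` have, by compactness of the sphere, a limiting direction `v`. It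
  -- is tangent, so `v = p v`, whereas the failed inequality would give `‖v - p v‖ ≥ ε` in the
  -- limit.
  by_contra! hcon
  choose x hxS hxn hx using fun n : ℕ => hcon (1 / (n + 1)) Nat.one_div_pos_of_nat
  have hx0 : ∀ n, x n ≠ 0 := by
    intro n h
    have := hx n
    simp [h] at this
  have hlim : Tendsto x atTop (𝓝 0) :=
    squeeze_zero_norm (fun n => (hxn n).le) tendsto_one_div_add_atTop_nhds_zero_nat
  have hsph : ∀ n, ‖x n‖⁻¹ • x n ∈ sphere (0 : E) 1 := by
    intro n
    rw [mem_sphere_zero_iff_norm, norm_smul, norm_inv, norm_norm,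
      inv_mul_cancel₀ (norm_ne_zero_iff.2 (hx0 n))]
  obtain ⟨v, -, φ, hφ, hv⟩ := (isCompact_sphere (0 : E) 1).tendsto_subseq hsph
  have hvt : v ∈ tangentSet S := hS.mem_tangentSet (u := x ∘ φ) (fun n => hxS _) (fun n => hx0 _)
    (hlim.comp hφ.tendsto_atTop) hv
  have hpv : v - p v = 0 := by
    have := hp ⟨v, hvt⟩
    rw [sub_eq_zero, this]
  have hc : Continuous fun w : E => ‖w - (p w : E)‖ := by fun_prop
  have h1 := (hc.tendsto v).comp hv
  rw [hpv, norm_zero] at h1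
  refine absurd (ge_of_tendsto' h1 (b := ε) fun n => ?_) (not_le.2 hε)
  have h2 := hx (φ n)
  have hpos : 0 < ‖x (φ n)‖ := norm_pos_iff.2 (hx0 _)
  simp only [Function.comp_apply, map_smul, Submodule.coe_smul, ← smul_sub]
  rw [norm_smul, norm_inv, norm_norm, ← div_eq_inv_mul, le_div_iff₀ hpos]
  exact h2.le

/-- Small tangent vectors are uniformly approximated by elements of the local subgroup. -/
theorem IsLocalSubgroup.exists_approx (hS : IsLocalSubgroup r m δ S) {ε : ℝ} (hε : 0 < ε) :
    ∃ R > 0, ∀ v : hS.tangent, ‖v‖ < R → ∃ h ∈ S, ‖h - v‖ ≤ ε * ‖v‖ := by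
  -- The definition of the tangent set treats one direction at a time; compactness of the unit
  -- sphere of the tangent space makes the approximation uniform.
  by_contra! hcon
  choose x hxn hx using fun n : ℕ => hcon (1 / (n + 1)) Nat.one_div_pos_of_nat
  have hx0 : ∀ n, x n ≠ 0 := by
    intro n h
    have := hx n 0 hS.zero_mem
    simp [h] at this
  have hlim : Tendsto x atTop (𝓝 0) :=
    squeeze_zero_norm (fun n => (hxn n).le) tendsto_one_div_add_atTop_nhds_zero_nat
  have hsph : ∀ n, ‖x n‖⁻¹ • x n ∈ sphere (0 : hS.tangent) 1 := by
    intro n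
    rw [mem_sphere_zero_iff_norm, norm_smul, norm_inv, norm_norm,
      inv_mul_cancel₀ (norm_ne_zero_iff.2 (hx0 n))]
  obtain ⟨v, -, φ, hφ, hv⟩ := (isCompact_sphere (0 : hS.tangent) 1).tendsto_subseq hsph
  have hvt := v.2 (ε / 2) (by positivity)
  have hn : Tendsto (fun n => ‖x (φ n)‖) atTop (𝓝[>] 0) :=
    tendsto_nhdsWithin_iff.2 ⟨tendsto_zero_iff_norm_tendsto_zero.1 (hlim.comp hφ.tendsto_atTop),
      Eventually.of_forall fun n => norm_pos_iff.2 (hx0 _)⟩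
  have e2 : ∀ᶠ n in atTop, ‖‖x (φ n)‖⁻¹ • x (φ n) - v‖ < ε / 2 :=
    (tendsto_iff_norm_sub_tendsto_zero.1 hv).eventually (Iio_mem_nhds (by positivity))
  obtain ⟨n, ⟨h, hh, hn1⟩, hn2⟩ := ((hn.eventually hvt).and e2).exists
  refine absurd (hx (φ n) h hh) (not_lt.2 ?_)
  have hpos : 0 < ‖x (φ n)‖ := norm_pos_iff.2 (hx0 _)
  have e3 : h - x (φ n) = (h - ‖x (φ n)‖ • (v : E)) -
      ‖x (φ n)‖ • ((‖x (φ n)‖⁻¹ • x (φ n) - v : hS.tangent) : E) := by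
    have : ‖x (φ n)‖ • (‖x (φ n)‖⁻¹ • (x (φ n) : E)) = x (φ n) := by
      rw [smul_smul, mul_inv_cancel₀ hpos.ne', one_smul]
    push_cast
    rw [smul_sub, this]
    abel
  rw [e3]
  refine (norm_sub_le _ _).trans ?_
  rw [norm_smul, norm_norm, Submodule.norm_coe]
  nlinarith

/-- The projection of a local subgroup to its tangent space is locally onto. -/
theorem IsLocalSubgroup.exists_proj_eq (hS : IsLocalSubgroup r m δ S)
    (p : E →L[ℝ] hS.tangent) (hp : ∀ v : hS.tangent, p v = v) :
    ∃ R > 0, ∀ a : hS.tangent, ‖a‖ < R → ∃ h ∈ S, p h = a ∧ ‖h‖ ≤ 4 * ‖a‖ := by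
  obtain ⟨ρ, hρ, hρr, C, hC0, hC⟩ := hS.exists_estimate
  obtain ⟨R₁, hR₁, hd⟩ := hS.norm_sub_proj_le p hp (ε := 1 / 2) (by norm_num)
  set M := ‖p‖ + 1 with hM
  have hM0 : 0 < M := by positivity
  have hpM : ∀ x, ‖p x‖ ≤ M * ‖x‖ := fun x =>
    (p.le_opNorm x).trans (by gcongr; linarith)
  obtain ⟨R₂, hR₂, happ⟩ := hS.exists_approx (ε := min (1 / (4 * M)) 1) (by positivity)
  set R := min (min (R₁ / 2) (ρ / 2)) r with hR
  have hR0 : 0 < R := by have := hS.pos; positivity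
  have hRr : R ≤ r := min_le_right _ _
  have hRρ : R < ρ := ((min_le_left _ _).trans (min_le_right _ _)).trans_lt (by linarith)
  have hRR₁ : R < R₁ := ((min_le_left _ _).trans (min_le_left _ _)).trans_lt (by linarith)
  have hcomp : IsCompact (S ∩ closedBall 0 R) := by
    have : S ∩ closedBall 0 R = (S ∩ closedBall 0 r) ∩ closedBall 0 R := by
      rw [inter_assoc, inter_eq_self_of_subset_right (closedBall_subset_closedBall hRr)]
    rw [this]
    exact (isCompact_closedBall _ _).inter_left hS.closed
  -- Below, `‖h‖ ≤ 4 * ‖a‖`, `‖k‖ ≤ 2 * ‖a‖` and the product error is at most `8 * ‖a‖`, which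
  -- explains `14`. The bound with `32` keeps the projected product error below `‖d‖ / 4`.
  refine ⟨min (min (R / 14) (1 / C)) (min R₂ (1 / (32 * M * C))), by positivity, fun a ha => ?_⟩
  rw [lt_min_iff, lt_min_iff, lt_min_iff, lt_div_iff₀ (by positivity), lt_div_iff₀ (by positivity),
    lt_div_iff₀ (by positivity)] at ha
  obtain ⟨⟨ha1, ha2⟩, ha3, ha4⟩ := ha
  -- The point of the compact piece of `S` whose projection is nearest to `a`. If a defect `d = a -
  -- p h` remained, multiplying `h` by some `k ∈ S` close to `d` would give a point of the same
  -- piece with defect at most `‖d‖ / 2`.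
  obtain ⟨h, ⟨hh, hhR⟩, hmin⟩ := hcomp.exists_isMinOn (f := fun x => ‖a - p x‖)
    ⟨0, hS.zero_mem, mem_closedBall_self hR0.le⟩ (by fun_prop)
  rw [isMinOn_iff] at hmin
  rw [mem_closedBall_zero_iff] at hhR
  have h0 := hmin 0 ⟨hS.zero_mem, mem_closedBall_self hR0.le⟩
  rw [map_zero, sub_zero] at h0
  have hph : ‖p h‖ ≤ 2 * ‖a‖ := by
    have : ‖p h‖ ≤ ‖a‖ + ‖a - p h‖ := by simpa using norm_sub_le a (a - p h)
    linarith
  have hh4 : ‖h‖ ≤ 4 * ‖a‖ := by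
    have h1 := hd h hh (by linarith)
    have h2 : ‖h‖ ≤ ‖h - p h‖ + ‖(p h : E)‖ := by
      simpa using norm_add_le (h - (p h : E)) (p h : E)
    rw [Submodule.norm_coe] at h2
    linarith
  refine ⟨h, hh, ?_, hh4⟩
  by_contra hne
  set d := a - p h with hdef
  have hd0 : 0 < ‖d‖ := norm_pos_iff.2 (sub_ne_zero.2 (Ne.symm hne))
  obtain ⟨k, hk, hkd⟩ := happ d (h0.trans_lt ha3)
  have hk1 : ‖k‖ ≤ 2 * ‖d‖ := by
    have : ‖k‖ ≤ ‖k - d‖ + ‖(d : E)‖ := by simpa using norm_add_le (k - (d : E)) (d : E)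
    rw [Submodule.norm_coe] at this
    nlinarith [min_le_right (1 / (4 * M)) 1]
  have hhb : h ∈ ball (0 : E) ρ := by rw [mem_ball_zero_iff]; linarith
  have ha0 := norm_nonneg a
  have hkb : k ∈ ball (0 : E) ρ := by rw [mem_ball_zero_iff]; linarith
  have e1 := hS.norm_mul_sub_le hρ hρr hC hhb hkb
  have e2 : C * ‖h‖ * ‖k‖ ≤ C * (4 * ‖a‖) * (2 * ‖d‖) := by gcongr
  have e3 : ‖m (h, k)‖ ≤ R := by
    have : ‖m (h, k)‖ ≤ ‖m (h, k) - h - k‖ + ‖h‖ + ‖k‖ := by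
      have := norm_add₃_le (a := m (h, k) - h - k) (b := h) (c := k)
      rwa [show m (h, k) - h - k + h + k = m (h, k) by abel] at this
    have : C * (4 * ‖a‖) * (2 * ‖d‖) ≤ 8 * ‖a‖ := by nlinarith
    linarith
  have e4 := hmin (m (h, k)) ⟨hS.mul_mem h hh k hk (ball_subset_ball hρr hhb)
    (ball_subset_ball hρr hkb), by rwa [mem_closedBall_zero_iff]⟩
  have e5 : a - p (m (h, k)) = -p (k - d) - p (m (h, k) - h - k) := by
    simp only [map_sub, hp, hdef]
    abel
  rw [e5] at e4
  have e6 : ‖p (k - d)‖ ≤ ‖d‖ / 4 := by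
    refine (hpM _).trans ?_
    calc M * ‖k - d‖ ≤ M * (1 / (4 * M) * ‖d‖) := by
          gcongr
          exact hkd.trans (by gcongr; exact min_le_left _ _)
      _ = ‖d‖ / 4 := by field_simp
  have e7 : ‖p (m (h, k) - h - k)‖ ≤ ‖d‖ / 4 := by
    refine (hpM _).trans ?_
    calc M * ‖m (h, k) - h - k‖ ≤ M * (C * (4 * ‖a‖) * (2 * ‖d‖)) := by
          gcongr; exact e1.trans e2
      _ = (‖a‖ * (32 * M * C)) * (‖d‖ / 4) := by ring
      _ ≤ 1 * (‖d‖ / 4) := by gcongr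
      _ = ‖d‖ / 4 := one_mul _
  have e8 := norm_sub_le (-p (k - d)) (p (m (h, k) - h - k))
  rw [norm_neg] at e8
  linarith

/-- The quotient `k = δ (x, y)` lies in `S`, so it is nearly tangent, and `y - x` differs from `k`
only by a small multiple of `‖k‖`. Hence `y - x` is nearly tangent too and is controlled by its
projection. This makes `p` injective on `S` near `0`, with Lipschitz inverse. -/
theorem IsLocalSubgroup.norm_sub_le_of_proj (hS : IsLocalSubgroup r m δ S)
    (p : E →L[ℝ] hS.tangent) (hp : ∀ v : hS.tangent, p v = v) :
    ∃ R > 0, R ≤ r ∧ ∀ x ∈ S, ∀ y ∈ S, ‖x‖ < R → ‖y‖ < R →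
      δ (x, y) ∈ S ∧ ‖y - x‖ ≤ 2 * ‖p y - p x‖ ∧ ‖δ (x, y)‖ ≤ 4 * ‖p y - p x‖ := by
  obtain ⟨ρ, hρ, hρr, C, hC0, hC, η, hη, hηρ, hCη, hdiv⟩ := hS.exists_div_estimate
  obtain ⟨R₁, hR₁, hd⟩ := hS.norm_sub_proj_le p hp (ε := 1 / 8) (by norm_num)
  set M := ‖p‖ + 1 with hM
  have hM0 : 0 < M := by positivity
  have hq : ∀ x : E, ‖x - p x‖ ≤ M * ‖x‖ := fun x => by
    have h1 := norm_sub_le x (p x : E)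
    rw [Submodule.norm_coe] at h1
    have := p.le_opNorm x
    rw [hM, add_mul]
    linarith
  refine ⟨min (min η (R₁ / 4)) (1 / (8 * M * C)), by positivity,
    ((min_le_left _ _).trans (min_le_left _ _)).trans (hηρ.trans hρr), ?_⟩
  intro x hx y hy hxR hyR
  rw [lt_min_iff, lt_min_iff] at hxR hyR
  obtain ⟨⟨hxη, hx1⟩, hx2⟩ := hxR
  obtain ⟨⟨hyη, hy1⟩, hy2⟩ := hyR
  rw [lt_div_iff₀ (by positivity)] at hx2
  have sub := ball_subset_ball (x := (0 : E)) (hηρ.trans hρr)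
  have hxb : x ∈ ball (0 : E) η := by rwa [mem_ball_zero_iff]
  have hyb : y ∈ ball (0 : E) η := by rwa [mem_ball_zero_iff]
  obtain ⟨-, d1, d2, -⟩ := hdiv x hxb y hyb
  have hkS := hS.div_mem x hx y hy (sub hxb) (sub hyb)
  set k := δ (x, y) with hk
  have hyx := norm_sub_le y x
  have e1 := hd k hkS (by linarith)
  have e2 := hq (y - x - k)
  have e3 : (y - x) - p (y - x) = (k - p k) + ((y - x - k) - p (y - x - k)) := by
    simp only [map_sub]; push_cast; abel
  have e4 : ‖(y - x) - p (y - x)‖ ≤ 1 / 8 * ‖k‖ + 1 / 8 * ‖k‖ := by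
    rw [e3]
    refine (norm_add_le _ _).trans (add_le_add e1 (e2.trans ?_))
    calc M * ‖y - x - k‖ ≤ M * (C * ‖x‖ * ‖k‖) := by gcongr
      _ = (‖x‖ * (8 * M * C)) * (1 / 8 * ‖k‖) := by ring
      _ ≤ 1 * (1 / 8 * ‖k‖) := by gcongr
      _ = _ := one_mul _
  have e5 : ‖y - x‖ ≤ ‖(y - x) - p (y - x)‖ + ‖(p (y - x) : E)‖ := by
    simpa using norm_add_le ((y - x) - (p (y - x) : E)) (p (y - x) : E)
  rw [Submodule.norm_coe] at e5
  have e6 : ‖p (y - x)‖ = ‖p y - p x‖ := by rw [map_sub]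
  exact ⟨hkS, by linarith, by linarith⟩

/-- A locally closed local subgroup is, near zero, the graph of a smooth map over its tangent
space. -/
theorem IsLocalSubgroup.exists_graph (hS : IsLocalSubgroup r m δ S)
    (p : E →L[ℝ] hS.tangent) (hp : ∀ v : hS.tangent, p v = v) :
    ∃ ε > 0, ∃ R > 0, ∃ g : hS.tangent → E, ContDiffOn ℝ ∞ g (ball 0 ε) ∧
      (∀ a ∈ ball 0 ε, g a ∈ S ∧ p (g a) = a) ∧ g 0 = 0 ∧
      ∀ x ∈ S, ‖x‖ < R → p x ∈ ball 0 ε ∧ g (p x) = x := by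
  obtain ⟨R₁, hR₁, hsurj⟩ := hS.exists_proj_eq p hp
  obtain ⟨R₂, hR₂, hR₂r, hinj⟩ := hS.norm_sub_le_of_proj p hp
  set ι := hS.tangent.subtypeL
  set A : E → E →L[ℝ] E := fun x => rightDeriv m (x, 0) with hA
  set B : E → hS.tangent →L[ℝ] hS.tangent := fun x => p.comp ((A x).comp ι) with hB
  have h0r := mem_ball_self (x := (0 : E)) hS.pos
  have hAs : ∀ x ∈ ball (0 : E) r, ContDiffAt ℝ ∞ A x := fun x hx =>
    (hS.contDiffAt_rightDeriv hx h0r).comp x (contDiffAt_id.prodMk contDiffAt_const)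
  have hBs : ∀ x ∈ ball (0 : E) r, ContDiffAt ℝ ∞ B x := fun x hx =>
    contDiffAt_const.clm_comp ((hAs x hx).clm_comp contDiffAt_const)
  have hB0 : B 0 = ContinuousLinearEquiv.refl ℝ hS.tangent := by
    ext v
    simp [hB, hA, hS.rightDeriv_zero h0r, ι, hp]
  have hinv : ∀ᶠ x in 𝓝 (0 : E), (B x).IsInvertible := by
    have := (hBs 0 h0r).continuousAt.eventually
      (p := fun T => T ∈ range ((↑) : (hS.tangent ≃L[ℝ] hS.tangent) → _))
      (by rw [hB0]; exact ContinuousLinearEquiv.nhds _)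
    exact this
  obtain ⟨R₃, hR₃, hinv⟩ := Metric.eventually_nhds_iff.1 hinv
  set R := min R₂ R₃ with hR
  have hR0 : 0 < R := lt_min hR₂ hR₃
  -- The lifts satisfy `‖g a‖ ≤ 4 * ‖a‖`, so they stay within radius `R`.
  set ε := min R₁ (R / 5) with hε
  have hε0 : 0 < ε := by positivity
  have hex : ∀ a : hS.tangent, ∃ h : E, a ∈ ball 0 ε → h ∈ S ∧ p h = a ∧ ‖h‖ ≤ 4 * ‖a‖ := by
    intro a
    by_cases ha : a ∈ ball 0 ε
    · obtain ⟨h, hh⟩ := hsurj a (by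
        rw [mem_ball_zero_iff] at ha; exact ha.trans_le (min_le_left _ _))
      exact ⟨h, fun _ => hh⟩
    · exact ⟨0, fun h => absurd h ha⟩
  choose g hg using hex
  have hgR : ∀ a ∈ ball 0 ε, ‖g a‖ < R := by
    intro a ha
    have := (hg a ha).2.2
    rw [mem_ball_zero_iff] at ha
    have := ha.trans_le (min_le_right R₁ (R / 5))
    linarith
  -- Write `g a' = m (g a, K a')` with `K a' ∈ S` of order `a' - a`. To first order `g a' - g a = A
  -- (g a) (K a')` and `K a' = p (K a')`. Applying `p` gives `a' - a = B (g a) (p (K a'))` to first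
  -- order, and inverting `B (g a)` yields the derivative, which depends on `a` only through `g a`.
  have hgder : ∀ a ∈ ball 0 ε, HasFDerivAt g (((A (g a)).comp ι).comp (B (g a)).inverse) a := by
    intro a ha
    have hgaR := hgR a ha
    have hgar : g a ∈ ball (0 : E) r := by
      rw [mem_ball_zero_iff]; exact (hgaR.trans_le (min_le_left _ _)).trans_le hR₂r
    have hi : (B (g a)).IsInvertible := hinv (by
      rw [dist_zero_right]; exact hgaR.trans_le (min_le_right _ _))
    have hev : ∀ᶠ a' in 𝓝 a, a' ∈ ball 0 ε := isOpen_ball.mem_nhds ha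
    set K : hS.tangent → E := fun a' => δ (g a, g a') with hK
    have hfacts : ∀ a' ∈ ball 0 ε, K a' ∈ S ∧ ‖g a' - g a‖ ≤ 2 * ‖a' - a‖ ∧
        ‖K a'‖ ≤ 4 * ‖a' - a‖ := by
      intro a' ha'
      have := hinj (g a) (hg a ha).1 (g a') (hg a' ha').1 (hgaR.trans_le (min_le_left _ _))
        ((hgR a' ha').trans_le (min_le_left _ _))
      rwa [(hg a ha).2.1, (hg a' ha').2.1] at this
    have hKO : K =O[𝓝 a] fun a' => a' - a :=
      IsBigO.of_bound 4 (hev.mono fun a' ha' => (hfacts a' ha').2.2)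
    have hK0 : Tendsto K (𝓝 a) (𝓝 0) := by
      refine hKO.trans_tendsto ?_
      have : Tendsto (fun a' : hS.tangent => a' - a) (𝓝 a) (𝓝 (a - a)) :=
        (continuous_sub_right a).tendsto a
      rwa [sub_self] at this
    have r1 : (fun a' => g a' - g a - A (g a) (K a')) =o[𝓝 a] fun a' => a' - a := by
      have h1 := (hasFDerivAt_iff_isLittleO.1
        (hS.hasFDerivAt_right hgar h0r)).comp_tendsto hK0
      have h2 : ((fun x' => x' - (0 : E)) ∘ K) = K := by ext; simp
      rw [h2] at h1
      refine (h1.trans_isBigO hKO).congr' ?_ EventuallyEq.rfl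
      filter_upwards [hev] with a' ha'
      have hga'r : g a' ∈ ball (0 : E) r := by
        rw [mem_ball_zero_iff]
        exact ((hgR a' ha').trans_le (min_le_left _ _)).trans_le hR₂r
      simp [hK, hA, hS.mul_div _ hgar _ hga'r, hS.zero_right _ hgar]
    have r2 : (fun a' => K a' - p (K a')) =o[𝓝 a] fun a' => a' - a := by
      refine IsLittleO.trans_isBigO ?_ hKO
      refine isLittleO_iff.2 fun c hc => ?_
      obtain ⟨R', hR', hd⟩ := hS.norm_sub_proj_le p hp hc
      filter_upwards [hev, hK0.eventually (ball_mem_nhds _ hR')] with a' ha' hKa'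
      exact hd _ (hfacts a' ha').1 (mem_ball_zero_iff.1 hKa')
    have r3 : (fun a' => g a' - g a - A (g a) (p (K a'))) =o[𝓝 a] fun a' => a' - a := by
      refine (r1.add (((A (g a)).isBigO_comp _ _).trans_isLittleO r2)).congr_left fun a' => ?_
      simp only [map_sub]
      abel
    set T := ((A (g a)).comp ι).comp (B (g a)).inverse with hT
    have r4 := r3.sub (((T.comp p).isBigO_comp _ _).trans_isLittleO r3)
    refine hasFDerivAt_iff_isLittleO.2 (r4.congr' ?_ EventuallyEq.rfl)
    filter_upwards [hev] with a' ha'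
    have h1 : p (g a' - g a - A (g a) (p (K a'))) = a' - a - B (g a) (p (K a')) := by
      rw [map_sub, map_sub, (hg a ha).2.1, (hg a' ha').2.1]
      rfl
    have h2 : (B (g a)).inverse (B (g a) (p (K a'))) = p (K a') := by
      have := hi.inverse_comp_self
      exact congrArg (fun f => f (p (K a'))) this
    rw [ContinuousLinearMap.comp_apply, h1, map_sub]
    have h3 : T (B (g a) (p (K a'))) = A (g a) (p (K a')) := by
      rw [hT, ContinuousLinearMap.comp_apply, h2]
      rfl
    rw [h3]
    abel
  have hgsm : ContDiffOn ℝ ∞ g (ball 0 ε) := by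
    refine contDiffOn_of_hasFDerivAt_comp
      (Ψ := fun x => ((A x).comp ι).comp (B x).inverse) isOpen_ball hgder fun a ha => ?_
    have hgaR := hgR a ha
    have hgar : g a ∈ ball (0 : E) r := by
      rw [mem_ball_zero_iff]; exact (hgaR.trans_le (min_le_left _ _)).trans_le hR₂r
    have hi : (B (g a)).IsInvertible := hinv (by
      rw [dist_zero_right]; exact hgaR.trans_le (min_le_right _ _))
    exact ((hAs _ hgar).clm_comp contDiffAt_const).clm_comp
      (hi.contDiffAt_map_inverse.comp _ (hBs _ hgar))
  have hg0 : g 0 = 0 := by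
    have := (hg 0 (mem_ball_self hε0)).2.2
    simpa using this
  refine ⟨ε, hε0, min R₂ (ε / (‖p‖ + 1)), by positivity, g, hgsm,
    fun a ha => ⟨(hg a ha).1, (hg a ha).2.1⟩, hg0, fun x hx hxR => ?_⟩
  rw [lt_min_iff, lt_div_iff₀ (by positivity)] at hxR
  have hpx : p x ∈ ball 0 ε := by
    rw [mem_ball_zero_iff]
    nlinarith [p.le_opNorm x, norm_nonneg x]
  refine ⟨hpx, ?_⟩
  -- `x` and `g (p x)` are points of `S` with the same projection, hence equal.
  have := (hinj x hx (g (p x)) (hg _ hpx).1 hxR.1 ((hgR _ hpx).trans_le (min_le_left _ _))).2.1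
  rw [(hg _ hpx).2.1, sub_self, norm_zero, mul_zero] at this
  exact sub_eq_zero.1 (norm_le_zero_iff.1 this)

end LocalSubgroupGraph

end HiggsBundle

/-! ### Manifold structures on quotients -/

namespace HiggsBundle

open Set Filter Topology

section SmoothQuotient

variable {EM HM EN HN EB HB E' H' : Type*}
  [NormedAddCommGroup EM] [NormedSpace ℝ EM] [TopologicalSpace HM]
  [NormedAddCommGroup EN] [NormedSpace ℝ EN] [TopologicalSpace HN]
  [NormedAddCommGroup EB] [NormedSpace ℝ EB] [TopologicalSpace HB]
  [NormedAddCommGroup E'] [NormedSpace ℝ E'] [TopologicalSpace H']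
  {I : ModelWithCorners ℝ EM HM} {J : ModelWithCorners ℝ EN HN} {IB : ModelWithCorners ℝ EB HB}
  {I' : ModelWithCorners ℝ E' H'}
  {M N B M' : Type*} [TopologicalSpace M] [TopologicalSpace N] [TopologicalSpace B]
  [TopologicalSpace M']

/-- A smooth map with smooth local sections through every point of the base. -/
structure IsSmoothQuotient (I : ModelWithCorners ℝ EM HM) (IB : ModelWithCorners ℝ EB HB)
    [ChartedSpace HM M] [ChartedSpace HB B] (q : M → B) : Prop where
  contMDiff : ContMDiff I IB ∞ q
  exists_section : ∀ b : B, ∃ U : Set B, IsOpen U ∧ b ∈ U ∧ ∃ z : B → M,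
    ContMDiffOn IB I ∞ z U ∧ ∀ x ∈ U, q (z x) = x

/-- On the domain of a local section `z` one has `f = (f ∘ q) ∘ z`. This is the universal property
through which all maps out of the quotients are shown to be smooth. -/
theorem IsSmoothQuotient.contMDiffOn_of_comp [ChartedSpace HM M] [ChartedSpace HB B]
    [ChartedSpace H' M'] {q : M → B} (hq : IsSmoothQuotient I IB q) {f : B → M'} {O : Set B}
    (hO : IsOpen O) (hf : ContMDiffOn I I' ∞ (fun x => f (q x)) (q ⁻¹' O)) :
    ContMDiffOn IB I' ∞ f O := by
  intro b hb
  obtain ⟨U, hU, hbU, z, hz, hqz⟩ := hq.exists_section b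
  have h1 : ContMDiffOn IB I' ∞ (fun x => f (q (z x))) (U ∩ O) :=
    hf.comp (hz.mono inter_subset_left) fun x hx => by
      rw [mem_preimage, mem_preimage, hqz x hx.1]; exact hx.2
  have h2 : ContMDiffOn IB I' ∞ f (U ∩ O) := h1.congr fun x hx => by rw [hqz x hx.1]
  exact (h2.contMDiffAt ((hU.inter hO).mem_nhds ⟨hbU, hb⟩)).contMDiffWithinAt

theorem IsSmoothQuotient.contMDiff_of_comp [ChartedSpace HM M] [ChartedSpace HB B]
    [ChartedSpace H' M'] {q : M → B} (hq : IsSmoothQuotient I IB q) {f : B → M'}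
    (hf : ContMDiff I I' ∞ (fun x => f (q x))) : ContMDiff IB I' ∞ f :=
  contMDiffOn_univ.1 (hq.contMDiffOn_of_comp isOpen_univ hf.contMDiffOn)

theorem IsSmoothQuotient.id_prodMap [ChartedSpace HM M] [ChartedSpace HB B] [ChartedSpace H' M']
    {q : M → B} (hq : IsSmoothQuotient I IB q) :
    IsSmoothQuotient (I'.prod I) (I'.prod IB) (Prod.map (id : M' → M') q) where
  contMDiff := contMDiff_id.prodMap hq.contMDiff
  exists_section := by
    rintro ⟨a, b⟩
    obtain ⟨U, hU, hbU, z, hz, hqz⟩ := hq.exists_section b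
    exact ⟨univ ×ˢ U, isOpen_univ.prod hU, ⟨mem_univ _, hbU⟩, Prod.map id z,
      contMDiffOn_id.prodMap hz, fun x hx => Prod.ext rfl (hqz x.2 hx.2)⟩

/-- The manifold structure defined by charts whose composites with `q` are smooth and whose
inverses lift smoothly through `q`. -/
theorem exists_isSmoothQuotient_of_charts {d : ℕ} [ChartedSpace HM M] {q : M → B}
    (hq : Continuous q)
    (h : ∀ b, ∃ e : OpenPartialHomeomorph B (EuclideanSpace ℝ (Fin d)), b ∈ e.source ∧
      ContMDiffOn I (𝓡 d) ∞ (fun x => e (q x)) (q ⁻¹' e.source) ∧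
      ∃ σ : EuclideanSpace ℝ (Fin d) → M, ContMDiffOn (𝓡 d) I ∞ σ e.target ∧
        ∀ y ∈ e.target, q (σ y) = e.symm y) :
    ∃ _ : ChartedSpace (EuclideanSpace ℝ (Fin d)) B,
      IsManifold (𝓡 d) ∞ B ∧ IsSmoothQuotient I (𝓡 d) q := by
  choose e he hsm σ hσ hqσ using h
  let cs : ChartedSpace (EuclideanSpace ℝ (Fin d)) B :=
    { atlas := range e
      chartAt := e
      mem_chart_source := he
      chart_mem_atlas := fun b => ⟨b, rfl⟩ }
  have mf : IsManifold (𝓡 d) ∞ B := by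
    apply isManifold_of_contDiffOn
    rintro _ _ ⟨b, rfl⟩ ⟨b', rfl⟩
    -- A transition map factors through `M`: lift by `σ b`, then apply `e b' ∘ q`.
    have key : ContMDiffOn (𝓡 d) (𝓡 d) ∞ (fun y => e b' (q (σ b y)))
        ((e b).symm ≫ₕ e b').source := by
      refine (hsm b').comp ((hσ b).mono ?_) ?_
      · intro y hy
        simp only [mfld_simps] at hy
        exact hy.1
      · intro y hy
        simp only [mfld_simps] at hy
        rw [mem_preimage, mem_preimage, hqσ b y hy.1]
        exact hy.2
    rw [contMDiffOn_iff_contDiffOn] at key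
    refine (key.congr fun y hy => ?_).mono ?_
    · simp only [mfld_simps] at hy ⊢
      rw [hqσ b y hy.1]
    · intro y hy
      simpa only [mfld_simps] using hy
  have hmax : ∀ b, e b ∈ IsManifold.maximalAtlas (𝓡 d) ∞ B := fun b =>
    IsManifold.subset_maximalAtlas ⟨b, rfl⟩
  refine ⟨cs, mf, ⟨?_, fun b => ⟨(e b).source, (e b).open_source, he b, fun x => σ b (e b x),
    (hσ b).comp (contMDiffOn_of_mem_maximalAtlas (hmax b)) (e b).mapsTo, fun x hx => ?_⟩⟩⟩
  · intro x
    have h1 : ContMDiffOn I (𝓡 d) ∞ (fun x' => (e (q x)).symm (e (q x) (q x')))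
        (q ⁻¹' (e (q x)).source) :=
      (contMDiffOn_symm_of_mem_maximalAtlas (hmax (q x))).comp (hsm (q x))
        fun y hy => (e (q x)).mapsTo hy
    have h2 := h1.congr (f₁ := q) fun y hy => ((e (q x)).left_inv hy).symm
    exact h2.contMDiffAt (((e (q x)).open_source.preimage hq).mem_nhds (he (q x)))
  · rw [hqσ b _ ((e b).mapsTo hx), (e b).left_inv hx]

/-- An open partial homeomorphism on the target of an open quotient map `q`, induced by a map `t`
that is constant on the fibres of `q` and a map `s` that inverts `t` up to the fibres of `q`. -/
noncomputable def quotientHomeomorph {q : M → B} (hq : IsOpenQuotientMap q) (U : Set B)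
    (T : Set N) (hU : IsOpen U) (hT : IsOpen T) (t : M → N) (s : N → M)
    (ht : ContinuousOn t (q ⁻¹' U)) (hs : ContinuousOn s T)
    (hst : ∀ y ∈ T, q (s y) ∈ U ∧ t (s y) = y)
    (hts : ∀ x, q x ∈ U → t x ∈ T ∧ q (s (t x)) = q x)
    (hconst : ∀ x x', q x ∈ U → q x = q x' → t x = t x') : OpenPartialHomeomorph B N where
  -- On `U` the choice of the preimage is immaterial, by `hconst`.
  toFun b := t (Function.surjInv hq.surjective b)
  invFun y := q (s y)
  source := U
  target := T
  map_source' b hb := (hts _ (by rwa [Function.surjInv_eq hq.surjective])).1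
  map_target' y hy := (hst y hy).1
  left_inv' b hb := by
    rw [(hts _ (by rwa [Function.surjInv_eq hq.surjective])).2, Function.surjInv_eq hq.surjective]
  right_inv' y hy := by
    rw [hconst _ (s y) _ (Function.surjInv_eq hq.surjective _), (hst y hy).2]
    rw [Function.surjInv_eq hq.surjective]
    exact (hst y hy).1
  open_source := hU
  open_target := hT
  continuousOn_toFun := by
    rw [continuousOn_open_iff hU]
    intro V hV
    have h1 := (continuousOn_open_iff (hU.preimage hq.continuous)).1 ht V hV
    have h2 := hq.isOpenMap _ h1
    convert h2 using 1
    ext b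
    constructor
    · rintro ⟨hb, hbV⟩
      exact ⟨_, ⟨by rwa [mem_preimage, Function.surjInv_eq hq.surjective], hbV⟩,
        Function.surjInv_eq hq.surjective b⟩
    · rintro ⟨x, ⟨hxU, hxV⟩, rfl⟩
      refine ⟨hxU, ?_⟩
      rw [mem_preimage, ← hconst x _ hxU (Function.surjInv_eq hq.surjective _).symm]
      exact hxV
  continuousOn_invFun := hq.continuous.comp_continuousOn hs

/-- Local data for a manifold structure on the target of `q`, modelled on the manifold `N`. -/
structure LocalSlice (I : ModelWithCorners ℝ EM HM) (J : ModelWithCorners ℝ EN HN)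
    [ChartedSpace HM M] [ChartedSpace HN N] (q : M → B) (U : Set B) (T : Set N)
    (t : M → N) (s : N → M) : Prop where
  isOpen_base : IsOpen U
  isOpen_target : IsOpen T
  smooth : ContMDiffOn I J ∞ t (q ⁻¹' U)
  smooth_inv : ContMDiffOn J I ∞ s T
  right_inv : ∀ y ∈ T, q (s y) ∈ U ∧ t (s y) = y
  left_inv : ∀ x, q x ∈ U → t x ∈ T ∧ q (s (t x)) = q x
  const : ∀ x x', q x ∈ U → q x = q x' → t x = t x'

/-- The open partial homeomorphism of a local slice. -/
noncomputable def LocalSlice.homeomorph [ChartedSpace HM M] [ChartedSpace HN N] {q : M → B}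
    {U : Set B} {T : Set N} {t : M → N} {s : N → M} (h : LocalSlice I J q U T t s)
    (hq : IsOpenQuotientMap q) : OpenPartialHomeomorph B N :=
  quotientHomeomorph hq U T h.isOpen_base h.isOpen_target t s h.smooth.continuousOn
    h.smooth_inv.continuousOn h.right_inv h.left_inv h.const

theorem LocalSlice.homeomorph_apply [ChartedSpace HM M] [ChartedSpace HN N] {q : M → B}
    {U : Set B} {T : Set N} {t : M → N} {s : N → M} (h : LocalSlice I J q U T t s)
    (hq : IsOpenQuotientMap q) {x : M} (hx : q x ∈ U) : h.homeomorph hq (q x) = t x :=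
  h.const _ _ (by rwa [Function.surjInv_eq hq.surjective]) (Function.surjInv_eq hq.surjective _)

/-- A chart of `B` is a slice homeomorphism to `N` followed by a chart of `N`. The linear
equivalence `L` is there because the model space of `N` is often a product rather than a standard
Euclidean space. -/
theorem exists_isSmoothQuotient {d : ℕ} [ChartedSpace HM M] [ChartedSpace HN N]
    [IsManifold J ∞ N] [J.Boundaryless] (L : EN ≃L[ℝ] EuclideanSpace ℝ (Fin d)) {q : M → B}
    (hq : IsOpenQuotientMap q)
    (h : ∀ b, ∃ (U : Set B) (T : Set N) (t : M → N) (s : N → M),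
      b ∈ U ∧ LocalSlice I J q U T t s) :
    ∃ _ : ChartedSpace (EuclideanSpace ℝ (Fin d)) B,
      IsManifold (𝓡 d) ∞ B ∧ IsSmoothQuotient I (𝓡 d) q := by
  refine exists_isSmoothQuotient_of_charts hq.continuous fun b => ?_
  obtain ⟨U, T, t, s, hb, hl⟩ := h b
  set c := chartAt HN (hl.homeomorph hq b) with hc
  set e := hl.homeomorph hq ≫ₕ c ≫ₕ
    (J.toHomeomorph.trans L.toHomeomorph).toOpenPartialHomeomorph with he
  have hsrc : e.source = U ∩ hl.homeomorph hq ⁻¹' c.source := by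
    simp only [he, mfld_simps]; rfl
  have htgt : ∀ y ∈ e.target, J.symm (L.symm y) ∈ c.target ∧ c.symm (J.symm (L.symm y)) ∈ T := by
    intro y hy
    simp only [he, mfld_simps] at hy
    exact hy
  have hcm : c ∈ IsManifold.maximalAtlas J ∞ N := IsManifold.chart_mem_maximalAtlas _
  refine ⟨e, ?_, ?_, fun y => s (c.symm (J.symm (L.symm y))), ?_, fun y hy => rfl⟩
  · rw [hsrc]; exact ⟨hb, mem_chart_source _ _⟩
  · have h1 : ContMDiffOn I (𝓡 d) ∞ (fun x => L (J (c (t x)))) (q ⁻¹' e.source) := by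
      refine L.contDiff.contMDiff.comp_contMDiffOn ?_
      refine (c.contMDiffOn_extend hcm).comp (hl.smooth.mono ?_) ?_
      · rw [hsrc]; exact fun x hx => hx.1
      · intro x hx
        rw [hsrc] at hx
        have := hx.2
        rwa [mem_preimage, hl.homeomorph_apply hq hx.1] at this
    refine h1.congr fun x hx => ?_
    rw [hsrc] at hx
    rw [← hl.homeomorph_apply hq hx.1]
    rfl
  · refine hl.smooth_inv.comp ?_ fun y hy => (htgt y hy).2
    refine (contMDiffOn_symm_of_mem_maximalAtlas hcm).comp ?_ fun y hy => (htgt y hy).1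
    refine J.contMDiffOn_symm.comp L.symm.contDiff.contMDiff.contMDiffOn fun y hy => ?_
    rw [J.range_eq_univ]; exact mem_univ _

/-- A space that maps continuously to a Hausdorff space, locally injectively over the base into
Hausdorff spaces, is Hausdorff. -/
theorem t2Space_of_locally_injective {Y X F : Type*} [TopologicalSpace Y] [TopologicalSpace X]
    [TopologicalSpace F] [T2Space X] [T2Space F] {ϖ : Y → X} (hϖ : Continuous ϖ)
    (h : ∀ x, ∃ U : Set X, IsOpen U ∧ x ∈ U ∧ ∃ f : Y → F, ContinuousOn f (ϖ ⁻¹' U) ∧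
      InjOn f (ϖ ⁻¹' U)) : T2Space Y := by
  refine ⟨fun y y' hne => ?_⟩
  by_cases hy : ϖ y = ϖ y'
  · obtain ⟨U, hU, hyU, f, hf, hinj⟩ := h (ϖ y)
    have hfy : f y ≠ f y' := fun h => hne (hinj hyU (by rwa [mem_preimage, ← hy]) h)
    obtain ⟨O, O', hO, hO', hyO, hyO', hd⟩ := t2_separation hfy
    have hU' := hU.preimage hϖ
    refine ⟨ϖ ⁻¹' U ∩ f ⁻¹' O, ϖ ⁻¹' U ∩ f ⁻¹' O', (continuousOn_open_iff hU').1 hf O hO,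
      (continuousOn_open_iff hU').1 hf O' hO', ⟨hyU, hyO⟩, ⟨by rwa [mem_preimage, ← hy], hyO'⟩, ?_⟩
    exact (hd.preimage f).mono inter_subset_right inter_subset_right
  · obtain ⟨O, O', hO, hO', hyO, hyO', hd⟩ := t2_separation hy
    exact ⟨ϖ ⁻¹' O, ϖ ⁻¹' O', hO.preimage hϖ, hO'.preimage hϖ, hyO, hyO', hd.preimage ϖ⟩

end SmoothQuotient

end HiggsBundle

/-! ### The closed subgroup theorem -/

namespace HiggsBundle

open Set Filter Topology

section ClosedSubgroup

variable {dG : ℕ} {G : Type*} [TopologicalSpace G] [ChartedSpace (EuclideanSpace ℝ (Fin dG)) G]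

theorem exists_centered_chart [IsManifold (𝓡 dG) ∞ G] (x : G) :
    ∃ κ : OpenPartialHomeomorph G (EuclideanSpace ℝ (Fin dG)),
      κ ∈ IsManifold.maximalAtlas (𝓡 dG) ∞ G ∧ x ∈ κ.source ∧ κ x = 0 := by
  set c := chartAt (EuclideanSpace ℝ (Fin dG)) x
  have hc : c ∈ IsManifold.maximalAtlas (𝓡 dG) ∞ G := IsManifold.chart_mem_maximalAtlas x
  refine ⟨c ≫ₕ (Homeomorph.subRight (c x)).toOpenPartialHomeomorph, ?_, ?_, ?_⟩
  · refine OpenPartialHomeomorph.mem_maximalAtlas_of_contMDiffOn _ ?_ ?_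
    · have h1 : ContMDiff (𝓡 dG) (𝓡 dG) ∞ fun y => y - c x :=
        (contDiff_id.sub contDiff_const).contMDiff
      exact h1.comp_contMDiffOn ((contMDiffOn_of_mem_maximalAtlas hc).mono (by simp [c]))
    · have h1 : ContMDiff (𝓡 dG) (𝓡 dG) ∞ fun y => y + c x :=
        (contDiff_id.add contDiff_const).contMDiff
      exact (contMDiffOn_symm_of_mem_maximalAtlas hc).comp h1.contMDiffOn
        fun y hy => by simpa [c] using hy
  · simp [c]
  · simp

variable [Group G] [LieGroup (𝓡 dG) ∞ G]

/-- A closed subgroup, read in a chart centred at the identity, is a local subgroup. -/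
theorem exists_isLocalSubgroup (H : Subgroup G) (hH : IsClosed (H : Set G))
    {κ : OpenPartialHomeomorph G (EuclideanSpace ℝ (Fin dG))}
    (hκ : κ ∈ IsManifold.maximalAtlas (𝓡 dG) ∞ G) (h1 : 1 ∈ κ.source) (h0 : κ 1 = 0) :
    ∃ r, IsLocalSubgroup r (fun z => κ (κ.symm z.1 * κ.symm z.2))
      (fun z => κ ((κ.symm z.1)⁻¹ * κ.symm z.2)) {x | x ∈ κ.target ∧ κ.symm x ∈ H} := by
  have := topologicalGroup_of_lieGroup (𝓡 dG) ∞ (G := G)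
  set E := EuclideanSpace ℝ (Fin dG)
  have h0t : (0 : E) ∈ κ.target := by rw [← h0]; exact κ.mapsTo h1
  have hs0 : κ.symm 0 = 1 := by rw [← h0, κ.left_inv h1]
  have hc : ContinuousAt κ.symm 0 := κ.symm.continuousAt h0t
  have hcf : ContinuousAt (fun z : E × E => κ.symm z.1) (0, 0) :=
    ContinuousAt.comp (f := Prod.fst) (x := ((0 : E), (0 : E))) hc continuousAt_fst
  have hcs : ContinuousAt (fun z : E × E => κ.symm z.2) (0, 0) :=
    ContinuousAt.comp (f := Prod.snd) (x := ((0 : E), (0 : E))) hc continuousAt_snd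
  have n1 : ∀ᶠ z in 𝓝 ((0 : E), (0 : E)), κ.symm z.1 * κ.symm z.2 ∈ κ.source :=
    (hcf.mul hcs).eventually (κ.open_source.mem_nhds (by simpa [hs0] using h1))
  have n2 : ∀ᶠ z in 𝓝 ((0 : E), (0 : E)), (κ.symm z.1)⁻¹ * κ.symm z.2 ∈ κ.source :=
    (hcf.inv.mul hcs).eventually (κ.open_source.mem_nhds (by simpa [hs0] using h1))
  obtain ⟨ε, hε, hball⟩ := Metric.eventually_nhds_iff.1 (n1.and n2)
  obtain ⟨ε', hε', hball'⟩ := Metric.nhds_basis_closedBall.mem_iff.1 (κ.open_target.mem_nhds h0t)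
  -- `ε` keeps products and quotients in the domain of the chart; `ε'` puts the closed ball inside
  -- its target, so that closedness of `H` passes to the part of the local subgroup in that ball.
  set r := min ε ε'
  have hr : 0 < r := lt_min hε hε'
  have hrt : Metric.closedBall (0 : E) r ⊆ κ.target :=
    (Metric.closedBall_subset_closedBall (min_le_right _ _)).trans hball'
  have hrt' : Metric.ball (0 : E) r ⊆ κ.target := Metric.ball_subset_closedBall.trans hrt
  have hmem : ∀ x ∈ Metric.ball (0 : E) r, ∀ y ∈ Metric.ball (0 : E) r,
      κ.symm x * κ.symm y ∈ κ.source ∧ (κ.symm x)⁻¹ * κ.symm y ∈ κ.source := by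
    intro x hx y hy
    refine hball (y := (x, y)) ?_
    rw [Prod.dist_eq]
    exact max_lt (hx.trans_le (min_le_left _ _)) (hy.trans_le (min_le_left _ _))
  have h0r : (0 : E) ∈ Metric.ball (0 : E) r := Metric.mem_ball_self hr
  refine ⟨r, hr, ?_, ?_, ?_, ?_, ?_, ?_, ?_, ?_, ?_, ?_⟩
  · rw [← contMDiffOn_iff_contDiffOn]
    have hsymm := contMDiffOn_symm_of_mem_maximalAtlas hκ
    have s1 : ContMDiffOn 𝓘(ℝ, E × E) (𝓡 dG) ∞ (fun z : E × E => κ.symm z.1)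
        (Metric.ball 0 r ×ˢ Metric.ball 0 r) :=
      hsymm.comp contDiff_fst.contMDiff.contMDiffOn fun z hz => hrt' hz.1
    have s2 : ContMDiffOn 𝓘(ℝ, E × E) (𝓡 dG) ∞ (fun z : E × E => κ.symm z.2)
        (Metric.ball 0 r ×ˢ Metric.ball 0 r) :=
      hsymm.comp contDiff_snd.contMDiff.contMDiffOn fun z hz => hrt' hz.2
    exact (contMDiffOn_of_mem_maximalAtlas hκ).comp (s1.mul s2)
      fun z hz => (hmem _ hz.1 _ hz.2).1
  · intro y hy
    simp only [hs0, one_mul]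
    exact κ.right_inv (hrt' hy)
  · intro x hx
    simp only [hs0, mul_one]
    exact κ.right_inv (hrt' hx)
  · exact ⟨h0t, by rw [hs0]; exact H.one_mem⟩
  · intro x hx y hy hxr hyr
    have hm := (hmem x hxr y hyr).1
    refine ⟨κ.mapsTo hm, ?_⟩
    rw [κ.left_inv hm]
    exact H.mul_mem hx.2 hy.2
  · intro x hx y hy hxr hyr
    have hm := (hmem x hxr y hyr).2
    refine ⟨κ.mapsTo hm, ?_⟩
    rw [κ.left_inv hm]
    exact H.mul_mem (H.inv_mem hx.2) hy.2
  · intro x hxr y hyr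
    simp only
    rw [κ.left_inv (hmem x hxr y hyr).2, mul_inv_cancel_left, κ.right_inv (hrt' hyr)]
  · refine ContinuousAt.comp (g := κ) ?_ (hcf.inv.mul hcs)
    simp only [hs0, inv_one, mul_one]
    exact κ.continuousAt h1
  · simp [hs0, h0]
  · have h2 := (κ.continuousOn_symm.mono hrt).preimage_isClosed_of_isClosed
      Metric.isClosed_closedBall hH
    have h3 : {x | x ∈ κ.target ∧ κ.symm x ∈ H} ∩ Metric.closedBall (0 : E) r =
        Metric.closedBall (0 : E) r ∩ κ.symm ⁻¹' H :=
      Set.ext fun x => ⟨fun ⟨⟨_, h⟩, h'⟩ => ⟨h', h⟩, fun ⟨h', h⟩ => ⟨⟨hrt h', h⟩, h'⟩⟩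
    rw [h3]
    exact h2

/-- A closed subgroup has an adapted chart at the identity. -/
theorem exists_adapted_chart (H : Subgroup G) (hH : IsClosed (H : Set G)) :
    ∃ (d : ℕ) (F : Submodule ℝ (EuclideanSpace ℝ (Fin dG)))
      (eqv : (EuclideanSpace ℝ (Fin d) × F) ≃L[ℝ] EuclideanSpace ℝ (Fin dG))
      (κ : OpenPartialHomeomorph G (EuclideanSpace ℝ (Fin dG))),
      κ ∈ IsManifold.maximalAtlas (𝓡 dG) ∞ G ∧ 1 ∈ κ.source ∧
      ∀ x ∈ κ.source, x ∈ H ↔ (eqv.symm (κ x)).2 = 0 := by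
  set E := EuclideanSpace ℝ (Fin dG)
  obtain ⟨κ, hκ, h1, h0⟩ := exists_centered_chart (dG := dG) (1 : G)
  obtain ⟨r, hS⟩ := exists_isLocalSubgroup H hH hκ h1 h0
  obtain ⟨p, hp⟩ := Submodule.ClosedComplemented.of_finiteDimensional hS.tangent
  obtain ⟨ε, hε, R, hR, g, hg, hgS, hg0, hgR⟩ := hS.exists_graph p hp
  set ι := hS.tangent.subtypeL
  set L : hS.tangent ≃L[ℝ] EuclideanSpace ℝ (Fin (Module.finrank ℝ hS.tangent)) := toEuclidean
  set f₁ : E →L[ℝ] EuclideanSpace ℝ (Fin (Module.finrank ℝ hS.tangent)) :=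
    (L : hS.tangent →L[ℝ] _).comp p
  set f₂ : EuclideanSpace ℝ (Fin (Module.finrank ℝ hS.tangent)) →L[ℝ] E :=
    ι.comp (L.symm : _ →L[ℝ] hS.tangent)
  have hinv : Function.RightInverse f₂ f₁ := fun y => by simp [f₁, f₂, ι, hp]
  set D : Set E := p ⁻¹' Metric.ball 0 ε
  have hD : IsOpen D := Metric.isOpen_ball.preimage p.continuous
  have hgp : ContDiffOn ℝ ∞ (fun x => g (p x)) D :=
    hg.comp p.contDiff.contDiffOn fun x hx => hx
  have hιp : ContDiff ℝ ∞ fun x => ι (p x) := ι.contDiff.comp p.contDiff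
  have hpι : ∀ x : E, p (ι (p x)) = p x := fun x => hp _
  have hs1 : ContDiffOn ℝ ∞ (fun x => x - g (p x) + ι (p x)) D :=
    (contDiffOn_id.sub hgp).add hιp.contDiffOn
  have hs2 : ContDiffOn ℝ ∞ (fun x => x + g (p x) - ι (p x)) D :=
    (contDiffOn_id.add hgp).sub hιp.contDiffOn
  have hp1 : ∀ x ∈ D, p (x - g (p x) + ι (p x)) = p x := fun x hx => by
    rw [map_add, map_sub, (hgS _ hx).2, hpι]; abel
  have hp2 : ∀ x ∈ D, p (x + g (p x) - ι (p x)) = p x := fun x hx => by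
    rw [map_sub, map_add, (hgS _ hx).2, hpι]; abel
  -- The shear along the kernel of `p` that carries the graph of `g` into the tangent space. It
  -- preserves `p`, so reversing the signs inverts it. Restricting to the ball of radius `R` ensures
  -- that every point of `S` in the domain lies on the graph.
  let χ : OpenPartialHomeomorph E E :=
    { toFun := fun x => x - g (p x) + ι (p x)
      invFun := fun x => x + g (p x) - ι (p x)
      source := D ∩ Metric.ball 0 R
      target := D ∩ (fun x => x + g (p x) - ι (p x)) ⁻¹' Metric.ball 0 R
      map_source' := fun x hx => by
        refine ⟨?_, ?_⟩
        · rw [mem_preimage, hp1 x hx.1]; exact hx.1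
        · rw [mem_preimage, hp1 x hx.1]
          convert hx.2 using 1
          abel
      map_target' := fun x hx => by
        refine ⟨?_, hx.2⟩
        rw [mem_preimage, hp2 x hx.1]; exact hx.1
      left_inv' := fun x hx => by rw [hp1 x hx.1]; abel
      right_inv' := fun x hx => by rw [hp2 x hx.1]; abel
      open_source := hD.inter Metric.isOpen_ball
      open_target := (continuousOn_open_iff hD).1 hs2.continuousOn _ Metric.isOpen_ball
      continuousOn_toFun := hs1.continuousOn.mono inter_subset_left
      continuousOn_invFun := hs2.continuousOn.mono inter_subset_left }
  refine ⟨_, _, (ContinuousLinearEquiv.equivOfRightInverse f₁ f₂ hinv).symm, κ ≫ₕ χ, ?_, ?_, ?_⟩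
  · refine OpenPartialHomeomorph.mem_maximalAtlas_of_contMDiffOn _ ?_ ?_
    · refine ContMDiffOn.comp (t := D) hs1.contMDiffOn
        ((contMDiffOn_of_mem_maximalAtlas hκ).mono ?_) ?_
      · intro x hx; exact hx.1
      · intro x hx; exact hx.2.1
    · refine (contMDiffOn_symm_of_mem_maximalAtlas hκ).comp
        (ContMDiffOn.mono hs2.contMDiffOn ?_) ?_
      · intro x hx; exact hx.1.1
      · intro x hx; exact hx.2
  · refine ⟨h1, ?_, ?_⟩
    · change p (κ 1) ∈ Metric.ball _ ε
      rw [h0, map_zero]; exact Metric.mem_ball_self hε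
    · change κ 1 ∈ Metric.ball 0 R
      rw [h0]; exact Metric.mem_ball_self hR
  · rintro x ⟨hxκ, hxD, hxR⟩
    change x ∈ κ.source at hxκ
    change κ x ∈ D at hxD
    change κ x ∈ Metric.ball 0 R at hxR
    have hker : ((ContinuousLinearEquiv.equivOfRightInverse f₁ f₂ hinv).symm.symm
        ((κ ≫ₕ χ) x)).2 = 0 ↔ κ x = g (p (κ x)) := by
      rw [← Submodule.coe_eq_zero, ContinuousLinearEquiv.symm_symm]
      have e1 : (((ContinuousLinearEquiv.equivOfRightInverse f₁ f₂ hinv)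
          ((κ ≫ₕ χ) x)).2 : E) = (κ ≫ₕ χ) x - f₂ (f₁ ((κ ≫ₕ χ) x)) := rfl
      have e2 : (κ ≫ₕ χ) x = κ x - g (p (κ x)) + ι (p (κ x)) := rfl
      have e3 : ∀ y, f₂ (f₁ y) = ι (p y) := fun y => by simp [f₁, f₂]
      rw [e1, e3, e2, hp1 _ hxD, add_sub_cancel_right, sub_eq_zero]
    rw [hker]
    constructor
    · intro hx
      exact (hgR (κ x) ⟨κ.mapsTo hxκ, by rwa [κ.left_inv hxκ]⟩ (mem_ball_zero_iff.1 hxR)).2.symm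
    · intro hx
      have := (hgS _ hxD).1.2
      rwa [← hx, κ.left_inv hxκ] at this

/-- A subgroup with an adapted chart at the identity is an embedded Lie subgroup. -/
theorem isEmbeddedLieSubgroup_of_adapted_chart (H : Subgroup G) {d : ℕ} {F : Type*}
    [NormedAddCommGroup F] [NormedSpace ℝ F]
    (eqv : (EuclideanSpace ℝ (Fin d) × F) ≃L[ℝ] EuclideanSpace ℝ (Fin dG))
    (κ : OpenPartialHomeomorph G (EuclideanSpace ℝ (Fin dG)))
    (hκ : κ ∈ IsManifold.maximalAtlas (𝓡 dG) ∞ G) (h1 : 1 ∈ κ.source)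
    (hH : ∀ x ∈ κ.source, x ∈ H ↔ (eqv.symm (κ x)).2 = 0) :
    ∃ _ : ChartedSpace (EuclideanSpace ℝ (Fin d)) H, IsEmbeddedLieSubgroup (dG := dG) H d := by
  have := topologicalGroup_of_lieGroup (𝓡 dG) ∞ (G := G)
  have hex : ∀ y : EuclideanSpace ℝ (Fin d), ∃ h : H, eqv (y, 0) ∈ κ.target →
      (h : G) = κ.symm (eqv (y, 0)) := by
    intro y
    by_cases hy : eqv (y, 0) ∈ κ.target
    · exact ⟨⟨κ.symm (eqv (y, 0)), (hH _ (κ.symm.mapsTo hy)).2 (by simp [κ.right_inv hy])⟩,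
        fun _ => rfl⟩
    · exact ⟨1, fun h => absurd h hy⟩
  choose γ hγ using hex
  have hcont : Continuous fun y : EuclideanSpace ℝ (Fin d) => eqv (y, (0 : F)) := by fun_prop
  have hsm : ContDiff ℝ ∞ fun y : EuclideanSpace ℝ (Fin d) => eqv (y, (0 : F)) := by fun_prop
  have hsm' : ContDiff ℝ ∞ fun x : EuclideanSpace ℝ (Fin dG) => (eqv.symm x).1 := by fun_prop
  have hback : ∀ x ∈ κ.source, x ∈ H → eqv ((eqv.symm (κ x)).1, 0) = κ x := by
    intro x hx hxH
    rw [← (hH x hx).1 hxH, Prod.mk.eta, eqv.apply_symm_apply]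
  let e₁ : OpenPartialHomeomorph H (EuclideanSpace ℝ (Fin d)) :=
    { toFun := fun h => (eqv.symm (κ h)).1
      invFun := γ
      source := {h | (h : G) ∈ κ.source}
      target := {y | eqv (y, 0) ∈ κ.target}
      map_source' := fun h hh => by
        rw [mem_ofPred_eq, hback _ hh h.2]; exact κ.mapsTo hh
      map_target' := fun y hy => by
        rw [mem_ofPred_eq, hγ y hy]; exact κ.symm.mapsTo hy
      left_inv' := fun h hh => by
        have h2 := hback _ hh h.2
        apply Subtype.ext
        rw [hγ _ (by rw [h2]; exact κ.mapsTo hh), h2, κ.left_inv hh]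
      right_inv' := fun y hy => by simp [hγ y hy, κ.right_inv hy]
      open_source := κ.open_source.preimage continuous_subtype_val
      open_target := κ.open_target.preimage hcont
      continuousOn_toFun := hsm'.continuous.comp_continuousOn
        (κ.continuousOn.comp continuous_subtype_val.continuousOn fun h hh => hh)
      continuousOn_invFun := by
        rw [IsInducing.subtypeVal.continuousOn_iff]
        exact (κ.continuousOn_symm.comp hcont.continuousOn fun y hy => hy).congr
          fun y hy => hγ y hy }
  -- Left translates of the one chart at the identity. Transition maps, and the inclusion read in
  -- the translated charts, then come from left translations in `G`; the inclusion becomes `y ↦ eqv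
  -- (y, 0)`.
  let e : H → OpenPartialHomeomorph H (EuclideanSpace ℝ (Fin d)) := fun h =>
    (Homeomorph.mulLeft h⁻¹).toOpenPartialHomeomorph ≫ₕ e₁
  have hsrc : ∀ h h' : H, h' ∈ (e h).source ↔ ((h : G)⁻¹ * h' : G) ∈ κ.source := fun h h' => by
    simp [e, e₁]
  have htgt : ∀ (h : H) (y), y ∈ (e h).target ↔ eqv (y, 0) ∈ κ.target := fun h y => by
    simp [e, e₁]
  have happ : ∀ h h' : H, e h h' = (eqv.symm (κ ((h : G)⁻¹ * h'))).1 := fun h h' => rfl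
  have hsym : ∀ (h : H) (y), y ∈ (e h).target → ((e h).symm y : G) = h * κ.symm (eqv (y, 0)) := by
    intro h y hy
    have : ((e h).symm y : G) = (h⁻¹⁻¹ : H) * γ y := rfl
    rw [this, hγ y ((htgt h y).1 hy), inv_inv]
  have hκs : ContMDiffOn 𝓘(ℝ, EuclideanSpace ℝ (Fin d)) (𝓡 dG) ∞ (fun y => κ.symm (eqv (y, 0)))
      {y | eqv (y, 0) ∈ κ.target} :=
    (contMDiffOn_symm_of_mem_maximalAtlas hκ).comp hsm.contMDiff.contMDiffOn fun y hy => hy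
  let cs : ChartedSpace (EuclideanSpace ℝ (Fin d)) H :=
    { atlas := range e
      chartAt := e
      mem_chart_source := fun h => by rw [hsrc, inv_mul_cancel]; exact h1
      chart_mem_atlas := fun b => ⟨b, rfl⟩ }
  have mf : IsManifold (𝓡 d) ∞ H := by
    apply isManifold_of_contDiffOn
    rintro _ _ ⟨h, rfl⟩ ⟨h', rfl⟩
    have hmem : ∀ y ∈ ((e h).symm ≫ₕ e h').source, y ∈ (e h).target ∧
        (h' : G)⁻¹ * (h * κ.symm (eqv (y, 0))) ∈ κ.source := by
      intro y hy
      have hy' : y ∈ (e h).target ∧ (e h).symm y ∈ (e h').source := by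
        simpa only [mfld_simps] using hy
      refine ⟨hy'.1, ?_⟩
      rw [← hsym h y hy'.1]
      exact (hsrc _ _).1 hy'.2
    have key : ContMDiffOn (𝓡 d) (𝓡 d) ∞
        (fun y => (eqv.symm (κ ((h' : G)⁻¹ * (h * κ.symm (eqv (y, 0)))))).1)
        ((e h).symm ≫ₕ e h').source := by
      refine hsm'.contMDiff.comp_contMDiffOn
        ((contMDiffOn_of_mem_maximalAtlas hκ).comp ?_ fun y hy => (hmem y hy).2)
      exact contMDiff_mul_left.comp_contMDiffOn (contMDiff_mul_left.comp_contMDiffOn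
        (hκs.mono fun y hy => (htgt h y).1 (hmem y hy).1))
    rw [contMDiffOn_iff_contDiffOn] at key
    refine (key.congr fun y hy => ?_).mono ?_
    · simp only [mfld_simps]
      rw [happ, hsym h y (hmem y hy).1]
    · intro y hy
      simpa only [mfld_simps] using hy
  have himm : Manifold.IsImmersion (𝓡 d) (𝓡 dG) ∞ (Subtype.val : H → G) := by
    refine Manifold.IsImmersionOfComplement.isImmersion (F := F) fun h => ?_
    refine Manifold.IsImmersionAtOfComplement.mk_of_charts eqv (e h)
      ((Homeomorph.mulLeft (h : G)⁻¹).toOpenPartialHomeomorph ≫ₕ κ) ?_ ?_ ?_ ?_ ?_ ?_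
    · rw [hsrc, inv_mul_cancel]; exact h1
    · simpa using h1
    · exact IsManifold.subset_maximalAtlas ⟨h, rfl⟩
    · refine OpenPartialHomeomorph.mem_maximalAtlas_of_contMDiffOn _ ?_ ?_
      · exact (contMDiffOn_of_mem_maximalAtlas hκ).comp
          (contMDiff_mul_left (a := (h : G)⁻¹)).contMDiffOn fun x hx => by simpa using hx
      · exact (contMDiff_mul_left (a := (h : G)⁻¹⁻¹)).comp_contMDiffOn
          ((contMDiffOn_symm_of_mem_maximalAtlas hκ).mono fun x hx => by simpa using hx)
    · intro h' hh'
      simpa using (hsrc _ _).1 hh'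
    · intro y hy
      have hy' : y ∈ (e h).target := by simpa only [mfld_simps] using hy
      have : κ ((h : G)⁻¹ * ((e h).symm y : G)) = eqv (y, 0) := by
        rw [hsym h y hy', inv_mul_cancel_left, κ.right_inv ((htgt h y).1 hy')]
      exact this
  have hval := himm.contMDiff
  refine ⟨cs, ⟨?_, ⟨himm, IsEmbedding.subtypeVal⟩⟩⟩
  -- A continuous map into `H` is smooth once it is smooth into `G`, the inclusion being an
  -- immersion.
  have hmul : ContMDiff ((𝓡 d).prod (𝓡 d)) (𝓡 d) ∞ fun z : H × H => z.1 * z.2 :=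
    (ContMDiff.iff_comp_isImmersion himm).2 ⟨continuous_mul,
      (hval.comp contMDiff_fst).mul (hval.comp contMDiff_snd)⟩
  have hinv : ContMDiff (𝓡 d) (𝓡 d) ∞ fun z : H => z⁻¹ :=
    (ContMDiff.iff_comp_isImmersion himm).2 ⟨continuous_inv, hval.inv⟩
  have : ContMDiffMul (𝓡 d) ∞ H := ⟨hmul⟩
  exact ⟨hinv⟩

/-- **Closed subgroup theorem.** -/
theorem exists_isEmbeddedLieSubgroup (H : Subgroup G) (hH : IsClosed (H : Set G)) :
    ∃ (d : ℕ) (_ : ChartedSpace (EuclideanSpace ℝ (Fin d)) H),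
      IsEmbeddedLieSubgroup (dG := dG) H d := by
  obtain ⟨d, F, eqv, κ, hκ, h1, h⟩ := exists_adapted_chart (dG := dG) H hH
  exact ⟨d, isEmbeddedLieSubgroup_of_adapted_chart H eqv κ hκ h1 h⟩

end ClosedSubgroup

end HiggsBundle

/-! ### Slices and the homogeneous space `G ⧸ H` -/

namespace HiggsBundle

open Set Filter Topology

/-- The inverse function theorem, with smoothness on an open set. -/
theorem exists_smooth_inverse {E F : Type*} [NormedAddCommGroup E] [NormedSpace ℝ E]
    [CompleteSpace E] [NormedAddCommGroup F] [NormedSpace ℝ F] {f : E → F} {D : Set E}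
    (hD : IsOpen D) (hf : ContDiffOn ℝ ∞ f D) {a : E} (ha : a ∈ D) {f' : E ≃L[ℝ] F}
    (hf' : HasFDerivAt f (f' : E →L[ℝ] F) a) :
    ∃ e : OpenPartialHomeomorph E F, a ∈ e.source ∧ e.source ⊆ D ∧ (∀ x, e x = f x) ∧
      ContDiffOn ℝ ∞ e.symm e.target := by
  have hfa : ∀ x ∈ D, ContDiffAt ℝ ∞ f x := fun x hx => hf.contDiffAt (hD.mem_nhds hx)
  -- The points with invertible derivative form an open set; restricting to it makes the inverse
  -- smooth on its whole domain and not only at the image of `a`.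
  set D' := D ∩ fderiv ℝ f ⁻¹' range ((↑) : (E ≃L[ℝ] F) → E →L[ℝ] F)
  have hD' : IsOpen D' := (continuousOn_open_iff hD).1
    (hf.continuousOn_fderiv_of_isOpen hD (by simp)) _ ContinuousLinearEquiv.isOpen
  set e₀ := (hfa a ha).toOpenPartialHomeomorph f hf' (by simp)
  have hae : a ∈ e₀.source := (hfa a ha).mem_toOpenPartialHomeomorph_source hf' (by simp)
  have he₀ : ∀ x, e₀ x = f x := fun x => rfl
  refine ⟨e₀.restrOpen D' hD', ?_, ?_, he₀, ?_⟩
  · exact ⟨hae, ha, f', hf'.fderiv.symm⟩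
  · exact fun x hx => hx.2.1
  · intro y hy
    have hy' : y ∈ (e₀.restrOpen D' hD').target := hy
    have hmem := (e₀.restrOpen D' hD').map_target hy'
    obtain ⟨-, hxD, g', hg'⟩ := hmem
    refine ContDiffAt.contDiffWithinAt
      ((e₀.restrOpen D' hD').contDiffAt_symm (f₀' := g') hy' ?_ (hfa _ hxD))
    rw [hg']
    exact ((hfa _ hxD).differentiableAt (by simp)).hasFDerivAt

section Slice

variable {dG dH : ℕ} {G : Type*} [Group G] [TopologicalSpace G]
  [ChartedSpace (EuclideanSpace ℝ (Fin dG)) G] [LieGroup (𝓡 dG) ∞ G]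
  (H : Subgroup G) [ChartedSpace (EuclideanSpace ℝ (Fin dH)) H]

/-- Near the identity, a Lie group is the product of a transversal slice and the subgroup. -/
theorem exists_local_product (hH : IsEmbeddedLieSubgroup (dG := dG) H dH) :
    ∃ (c : ℕ) (σ : EuclideanSpace ℝ (Fin c) → G) (T : Set (EuclideanSpace ℝ (Fin c)))
      (N : Set G) (β : G → EuclideanSpace ℝ (Fin c)) (V : Set H),
      IsOpen T ∧ 0 ∈ T ∧ ContMDiffOn (𝓡 c) (𝓡 dG) ∞ σ T ∧ σ 0 = 1 ∧
      IsOpen N ∧ ContMDiffOn (𝓡 dG) (𝓡 c) ∞ β N ∧ (∀ g ∈ N, β g ∈ T ∧ ∃ h : H, g = σ (β g) * h) ∧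
      IsOpen V ∧ 1 ∈ V ∧ ∀ b ∈ T, ∀ h ∈ V, σ b * h ∈ N ∧ β (σ b * h) = b := by
  have := topologicalGroup_of_lieGroup (𝓡 dG) ∞ (G := G)
  have him := (hH.embedding.isImmersion.isImmersionAt (1 : H)).isImmersionAtOfComplement_complement
  have hfin : FiniteDimensional ℝ (hH.embedding.isImmersion.isImmersionAt (1 : H)).complement :=
    FiniteDimensional.of_injective
      (him.equiv.toLinearEquiv.toLinearMap ∘ₗ LinearMap.inr ℝ (EuclideanSpace ℝ (Fin dH)) _)
      (him.equiv.injective.comp (Prod.mk_right_injective 0))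
  set c := Module.finrank ℝ (hH.embedding.isImmersion.isImmersionAt (1 : H)).complement
  -- The abstract complement from the immersion is replaced by a Euclidean space, in which the slice
  -- is parametrized.
  have him' := him.trans_F (F' := EuclideanSpace ℝ (Fin c)) toEuclidean
  set φ := him'.domChart
  set ψ := him'.codChart
  set L := him'.equiv
  set F := EuclideanSpace ℝ (Fin c)
  set EH := EuclideanSpace ℝ (Fin dH)
  have hφ : φ ∈ IsManifold.maximalAtlas (𝓡 dH) ∞ H := him'.domChart_mem_maximalAtlas
  have hψ : ψ ∈ IsManifold.maximalAtlas (𝓡 dG) ∞ G := him'.codChart_mem_maximalAtlas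
  have h1φ : (1 : H) ∈ φ.source := him'.mem_domChart_source
  have h1ψ : (1 : G) ∈ ψ.source := him'.mem_codChart_source
  have hw : ∀ x ∈ φ.target, ψ (φ.symm x : G) = L (x, 0) := fun x hx =>
    him'.writtenInCharts (by simpa only [mfld_simps] using hx)
  set x₀ := φ 1 with hx₀
  have hx₀t : x₀ ∈ φ.target := φ.mapsTo h1φ
  have hψ1 : ψ 1 = L (x₀, 0) := by
    rw [← hw x₀ hx₀t, hx₀, φ.left_inv h1φ]; rfl
  set σ : F → G := fun b => ψ.symm (L (x₀, b)) with hσdef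
  set T₀ : Set F := (fun b => L (x₀, b)) ⁻¹' ψ.target
  have hLc : ContDiff ℝ ∞ fun b : F => L (x₀, b) := by fun_prop
  have hT₀ : IsOpen T₀ := ψ.open_target.preimage hLc.continuous
  have h0T₀ : (0 : F) ∈ T₀ := by
    change L (x₀, 0) ∈ ψ.target
    rw [← hψ1]; exact ψ.mapsTo h1ψ
  have hσ : ContMDiffOn (𝓡 c) (𝓡 dG) ∞ σ T₀ :=
    (contMDiffOn_symm_of_mem_maximalAtlas hψ).comp hLc.contMDiff.contMDiffOn fun b hb => hb
  have hσ0 : σ 0 = 1 := by rw [hσdef]; simp only; rw [← hψ1, ψ.left_inv h1ψ]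
  have hιφ : ContMDiffOn (𝓡 dH) (𝓡 dG) ∞ (fun x => (φ.symm x : G)) φ.target :=
    hH.embedding.contMDiff.comp_contMDiffOn (contMDiffOn_symm_of_mem_maximalAtlas hφ)
  set D₀ : Set (EH × F) := φ.target ×ˢ T₀
  have hD₀ : IsOpen D₀ := φ.open_target.prod hT₀
  have hμ : ContMDiffOn 𝓘(ℝ, EH × F) (𝓡 dG) ∞ (fun z : EH × F => σ z.2 * φ.symm z.1) D₀ :=
    (hσ.comp (f := Prod.snd) contDiff_snd.contMDiff.contMDiffOn fun z hz => hz.2).mul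
      (hιφ.comp (f := Prod.fst) contDiff_fst.contMDiff.contMDiffOn fun z hz => hz.1)
  set D : Set (EH × F) := D₀ ∩ (fun z : EH × F => σ z.2 * φ.symm z.1) ⁻¹' ψ.source
  have hD : IsOpen D := (continuousOn_open_iff hD₀).1 hμ.continuousOn _ ψ.open_source
  set Ψ : EH × F → EuclideanSpace ℝ (Fin dG) := fun z => ψ (σ z.2 * φ.symm z.1) with hΨ
  have hΨs : ContDiffOn ℝ ∞ Ψ D := by
    rw [← contMDiffOn_iff_contDiffOn]
    exact (contMDiffOn_of_mem_maximalAtlas hψ).comp (hμ.mono inter_subset_left) fun z hz => hz.2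
  have ha : (x₀, (0 : F)) ∈ D := by
    refine ⟨⟨hx₀t, h0T₀⟩, ?_⟩
    simp only [mem_preimage, hσ0, one_mul]
    rw [hx₀, φ.left_inv h1φ]; exact h1ψ
  have hΨd : HasFDerivAt Ψ (fderiv ℝ Ψ (x₀, 0)) (x₀, 0) :=
    ((hΨs.contDiffAt (hD.mem_nhds ha)).differentiableAt (by simp)).hasFDerivAt
  have hLd : ∀ z, HasFDerivAt L (L : EH × F →L[ℝ] EuclideanSpace ℝ (Fin dG)) z := fun z =>
    L.hasFDerivAt
  -- `Ψ` agrees with `L` on both coordinate slices through `(x₀, 0)`: for `b = 0` because `σ 0 = 1`,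
  -- for `x = x₀` because `φ.symm x₀ = 1`. Its derivative there is therefore the invertible map `L`.
  have d1 : (fderiv ℝ Ψ (x₀, 0)).comp (ContinuousLinearMap.inl ℝ EH F) =
      (L : EH × F →L[ℝ] EuclideanSpace ℝ (Fin dG)).comp (ContinuousLinearMap.inl ℝ EH F) := by
    refine (hΨd.comp x₀ (hasFDerivAt_prodMk_left x₀ (0 : F))).unique
      (((hLd (x₀, 0)).comp x₀
        (hasFDerivAt_prodMk_left x₀ (0 : F))).congr_of_eventuallyEq ?_)
    filter_upwards [φ.open_target.mem_nhds hx₀t] with x hx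
    simp only [Function.comp_apply, hΨ, hσ0, one_mul]
    exact hw x hx
  have d2 : (fderiv ℝ Ψ (x₀, 0)).comp (ContinuousLinearMap.inr ℝ EH F) =
      (L : EH × F →L[ℝ] EuclideanSpace ℝ (Fin dG)).comp (ContinuousLinearMap.inr ℝ EH F) := by
    refine (hΨd.comp (0 : F) (hasFDerivAt_prodMk_right x₀ (0 : F))).unique
      (((hLd (x₀, 0)).comp (0 : F)
        (hasFDerivAt_prodMk_right x₀ (0 : F))).congr_of_eventuallyEq ?_)
    filter_upwards [hT₀.mem_nhds h0T₀] with b hb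
    simp only [Function.comp_apply, hΨ]
    rw [hx₀, φ.left_inv h1φ, OneMemClass.coe_one, mul_one]
    exact ψ.right_inv hb
  have hΨ' : HasFDerivAt Ψ (L : EH × F →L[ℝ] EuclideanSpace ℝ (Fin dG)) (x₀, 0) := by
    have hLe : fderiv ℝ Ψ (x₀, 0) = (L : EH × F →L[ℝ] EuclideanSpace ℝ (Fin dG)) := by
      refine ContinuousLinearMap.ext fun z => ?_
      have e1 := congrArg (fun A => A z.1) d1
      have e2 := congrArg (fun A => A z.2) d2
      simp only [ContinuousLinearMap.comp_apply, ContinuousLinearMap.inl_apply,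
        ContinuousLinearMap.inr_apply] at e1 e2
      rw [← Prod.fst_add_snd z, map_add, map_add, e1, e2]
    rw [← hLe]
    exact hΨd
  obtain ⟨e, hae, heD, heΨ, hes⟩ := exists_smooth_inverse hD hΨs ha hΨ'
  obtain ⟨A, T, hA, hT, hxA, h0T, hAT⟩ := isOpen_prod_iff.1 e.open_source _ _ hae
  have hTT₀ : T ⊆ T₀ := fun b hb => (heD (hAT (show (x₀, b) ∈ A ×ˢ T from ⟨hxA, hb⟩))).1.2
  have hN₀ : IsOpen (ψ.source ∩ ψ ⁻¹' e.target) := ψ.isOpen_inter_preimage e.open_target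
  have hβ : ContMDiffOn (𝓡 dG) (𝓡 c) ∞ (fun g => (e.symm (ψ g)).2)
      (ψ.source ∩ ψ ⁻¹' e.target) :=
    contDiff_snd.contMDiff.comp_contMDiffOn (hes.contMDiffOn.comp
      ((contMDiffOn_of_mem_maximalAtlas hψ).mono inter_subset_left) fun g hg => hg.2)
  refine ⟨c, σ, T, (ψ.source ∩ ψ ⁻¹' e.target) ∩ (fun g => (e.symm (ψ g)).2) ⁻¹' T,
    fun g => (e.symm (ψ g)).2, φ.source ∩ φ ⁻¹' A, hT, h0T, hσ.mono hTT₀, hσ0,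
    (continuousOn_open_iff hN₀).1 hβ.continuousOn _ hT, hβ.mono inter_subset_left, ?_,
    φ.isOpen_inter_preimage hA, ⟨h1φ, hxA⟩, ?_⟩
  · rintro g ⟨⟨hg1, hg2⟩, hg3⟩
    refine ⟨hg3, φ.symm (e.symm (ψ g)).1, ?_⟩
    have hm := heD (e.map_target hg2)
    have h2 := e.right_inv hg2
    rw [heΨ] at h2
    exact (ψ.injOn hm.2 hg1 h2).symm
  · rintro b hb h ⟨hh, hhA⟩
    have hm : (φ h, b) ∈ e.source := hAT ⟨hhA, hb⟩
    have hm2 := (heD hm).2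
    have h3 : e (φ h, b) = ψ (σ b * h) := by
      rw [heΨ]; simp only [hΨ]; rw [φ.left_inv hh]
    simp only [mem_preimage] at hm2
    rw [φ.left_inv hh] at hm2
    have h4 : e.symm (ψ (σ b * h)) = (φ h, b) := by rw [← h3, e.left_inv hm]
    refine ⟨⟨⟨hm2, ?_⟩, ?_⟩, ?_⟩
    · rw [mem_preimage, ← h3]; exact e.mapsTo hm
    · rw [mem_preimage, h4]; exact hb
    · exact congrArg Prod.snd h4

/-- A saturated neighbourhood of an embedded subgroup is the product of a slice and the
subgroup. -/
theorem exists_saturated_product (hH : IsEmbeddedLieSubgroup (dG := dG) H dH) :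
    ∃ (c : ℕ) (σ : EuclideanSpace ℝ (Fin c) → G) (T : Set (EuclideanSpace ℝ (Fin c)))
      (O : Set G) (t : G → EuclideanSpace ℝ (Fin c)),
      IsOpen T ∧ ContMDiffOn (𝓡 c) (𝓡 dG) ∞ σ T ∧ IsOpen O ∧ ContMDiffOn (𝓡 dG) (𝓡 c) ∞ t O ∧
      1 ∈ O ∧ (∀ b ∈ T, ∀ h : H, σ b * h ∈ O ∧ t (σ b * h) = b) ∧
      ∀ g ∈ O, t g ∈ T ∧ ∃ h : H, g = σ (t g) * h := by
  have := topologicalGroup_of_lieGroup (𝓡 dG) ∞ (G := G)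
  obtain ⟨c, σ, T₀, N, β, V, hT₀, h0T₀, hσ, hσ0, hN, hβ, hβN, hV, h1V, hβσ⟩ :=
    exists_local_product H hH
  obtain ⟨V', hV', rfl⟩ := isOpen_induced_iff.1 hV
  -- The slice is shrunk until all quotients `(σ b')⁻¹ * σ b` lie in `V'`. As `H` carries the
  -- subspace topology, any such quotient belonging to `H` lies in `V`.
  have hq : ContinuousOn (fun z : EuclideanSpace ℝ (Fin c) × EuclideanSpace ℝ (Fin c) =>
      (σ z.1)⁻¹ * σ z.2) (T₀ ×ˢ T₀) :=
    ((hσ.continuousOn.comp continuousOn_fst fun z hz => hz.1).inv).mul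
      (hσ.continuousOn.comp continuousOn_snd fun z hz => hz.2)
  have hW := (continuousOn_open_iff (hT₀.prod hT₀)).1 hq V' hV'
  obtain ⟨A, B, hA, hB, h0A, h0B, hAB⟩ := isOpen_prod_iff.1 hW 0 0
    ⟨⟨h0T₀, h0T₀⟩, by simpa [hσ0] using h1V⟩
  set T := A ∩ B
  have hT : IsOpen T := hA.inter hB
  have hTT₀ : T ⊆ T₀ := fun b hb => (hAB (show (b, b) ∈ A ×ˢ B from hb)).1.1
  -- If two slice points share a coset, then `σ b = σ b' * k` with `k ∈ V`, and `β` recovers both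
  -- `b` and `b'` from this element.
  have hinj : ∀ b ∈ T, ∀ b' ∈ T, ∀ h h' : H, σ b * h = σ b' * h' → b = b' := by
    intro b hb b' hb' h h' heq
    have hk : ((h' * h⁻¹ : H) : G) = (σ b')⁻¹ * σ b := by
      rw [Subgroup.coe_mul, Subgroup.coe_inv, eq_inv_mul_iff_mul_eq, ← mul_assoc, ← heq,
        mul_inv_cancel_right]
    have hkV : h' * h⁻¹ ∈ (Subtype.val : H → G) ⁻¹' V' := by
      rw [mem_preimage, hk]
      exact (hAB (show (b', b) ∈ A ×ˢ B from ⟨hb'.1, hb.2⟩)).2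
    have e1 := (hβσ b' (hTT₀ hb') _ hkV).2
    rw [hk, mul_inv_cancel_left] at e1
    have e2 := (hβσ b (hTT₀ hb) 1 h1V).2
    rw [OneMemClass.coe_one, mul_one] at e2
    rw [← e1, e2]
  set O : Set G := {g | ∃ b ∈ T, ∃ h : H, g = σ b * h}
  have hex : ∀ g : G, ∃ b, g ∈ O → b ∈ T ∧ ∃ h : H, g = σ b * h := by
    intro g
    by_cases hg : g ∈ O
    · obtain ⟨b, hb⟩ := hg
      exact ⟨b, fun _ => hb⟩
    · exact ⟨0, fun h => absurd h hg⟩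
  choose t ht using hex
  have htσ : ∀ b ∈ T, ∀ h : H, t (σ b * h) = b := by
    intro b hb h
    obtain ⟨h1, h', h2⟩ := ht (σ b * h) ⟨b, hb, h, rfl⟩
    exact (hinj b hb _ h1 h h' h2).symm
  -- Near `σ b * h`, the coordinate `t` is `β` after right translation by `h⁻¹`; this gives openness
  -- of `O` and smoothness of `t` far from the identity as well.
  have hloc : ∀ g ∈ O, ∃ h : H, g ∈ (fun x => x * (h : G)⁻¹) ⁻¹' (N ∩ β ⁻¹' T) := by
    rintro g ⟨b, hb, h, rfl⟩
    have e2 := hβσ b (hTT₀ hb) 1 h1V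
    rw [OneMemClass.coe_one, mul_one] at e2
    refine ⟨h, ?_⟩
    rw [mem_preimage, mul_inv_cancel_right]
    exact ⟨e2.1, by rw [mem_preimage, e2.2]; exact hb⟩
  have hNT : IsOpen (N ∩ β ⁻¹' T) := (continuousOn_open_iff hN).1 hβ.continuousOn _ hT
  have hopen : ∀ h : H, IsOpen ((fun x => x * (h : G)⁻¹) ⁻¹' (N ∩ β ⁻¹' T)) := fun h =>
    hNT.preimage (continuous_mul_const _)
  have hdec : ∀ (h : H), ∀ x ∈ (fun x => x * (h : G)⁻¹) ⁻¹' (N ∩ β ⁻¹' T), ∃ k : H,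
      x = σ (β (x * (h : G)⁻¹)) * k := by
    intro h x hx
    obtain ⟨-, k, hk⟩ := hβN _ hx.1
    refine ⟨k * h, ?_⟩
    rw [Subgroup.coe_mul, ← mul_assoc, ← hk, inv_mul_cancel_right]
  refine ⟨c, σ, T, O, t, hT, hσ.mono hTT₀, ?_, ?_, ⟨0, ⟨h0A, h0B⟩, 1, by simp [hσ0]⟩,
    fun b hb h => ⟨⟨b, hb, h, rfl⟩, htσ b hb h⟩, ht⟩
  · refine isOpen_iff_mem_nhds.2 fun g hg => ?_
    obtain ⟨h, hh⟩ := hloc g hg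
    refine mem_of_superset ((hopen h).mem_nhds hh) fun x hx => ?_
    obtain ⟨k, hk⟩ := hdec h x hx
    exact ⟨_, hx.2, k, hk⟩
  · intro g hg
    obtain ⟨h, hh⟩ := hloc g hg
    have h1 : ContMDiffOn (𝓡 dG) (𝓡 c) ∞ (fun x => β (x * (h : G)⁻¹))
        ((fun x => x * (h : G)⁻¹) ⁻¹' (N ∩ β ⁻¹' T)) :=
      hβ.comp (contMDiff_mul_right (a := (h : G)⁻¹)).contMDiffOn fun x hx => hx.1
    have h2 := h1.congr (f₁ := t) fun x hx => by
      obtain ⟨k, hk⟩ := hdec h x hx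
      conv_lhs => rw [hk]
      exact htσ _ hx.2 k
    exact (h2.contMDiffAt ((hopen h).mem_nhds hh)).contMDiffWithinAt

/-- The homogeneous space of an embedded subgroup is a manifold. -/
theorem exists_isSmoothQuotient_mk (hH : IsEmbeddedLieSubgroup (dG := dG) H dH) :
    ∃ (c : ℕ) (_ : ChartedSpace (EuclideanSpace ℝ (Fin c)) (G ⧸ H)),
      IsManifold (𝓡 c) ∞ (G ⧸ H) ∧
      IsSmoothQuotient (𝓡 dG) (𝓡 c) (QuotientGroup.mk : G → G ⧸ H) := by
  have := topologicalGroup_of_lieGroup (𝓡 dG) ∞ (G := G)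
  obtain ⟨c, σ, T, O, t, hT, hσ, hO, ht, h1, hσt, htσ⟩ := exists_saturated_product H hH
  have hq : IsOpenQuotientMap (QuotientGroup.mk : G → G ⧸ H) := QuotientGroup.isOpenQuotientMap_mk
  have hsat : ∀ (g₀ x : G), (QuotientGroup.mk x : G ⧸ H) ∈
      (QuotientGroup.mk : G → G ⧸ H) '' ((fun x => g₀⁻¹ * x) ⁻¹' O) ↔ g₀⁻¹ * x ∈ O := by
    intro g₀ x
    refine ⟨?_, fun h => ⟨x, h, rfl⟩⟩
    rintro ⟨y, hy, hyx⟩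
    rw [QuotientGroup.eq] at hyx
    obtain ⟨hT', h, hh⟩ := htσ _ hy
    have := (hσt _ hT' (h * ⟨_, hyx⟩)).1
    rw [Subgroup.coe_mul, ← mul_assoc, ← hh] at this
    simpa [mul_assoc] using this
  refine ⟨c, exists_isSmoothQuotient (J := 𝓡 c) (N := EuclideanSpace ℝ (Fin c))
    (ContinuousLinearEquiv.refl ℝ _) hq fun b => ?_⟩
  obtain ⟨g₀, rfl⟩ := hq.surjective b
  refine ⟨(QuotientGroup.mk : G → G ⧸ H) '' ((fun x => g₀⁻¹ * x) ⁻¹' O), T, fun x => t (g₀⁻¹ * x),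
    fun b => g₀ * σ b, (hsat _ _).2 (by simpa using h1),
    ⟨hq.isOpenMap _ (hO.preimage (continuous_const_mul _)), hT, ?_, ?_, ?_, ?_, ?_⟩⟩
  · exact ht.comp (contMDiff_mul_left (a := g₀⁻¹)).contMDiffOn fun x hx => (hsat _ _).1 hx
  · exact contMDiff_mul_left.comp_contMDiffOn hσ
  · intro b hb
    have := hσt b hb 1
    rw [OneMemClass.coe_one, mul_one] at this
    rw [hsat, inv_mul_cancel_left]
    exact this
  · intro x hx
    obtain ⟨h2, h, hh⟩ := htσ _ ((hsat _ _).1 hx)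
    refine ⟨h2, ?_⟩
    rw [QuotientGroup.eq, mul_inv_rev, mul_assoc]
    nth_rw 2 [hh]
    simp
  · intro x x' hx hxx'
    rw [QuotientGroup.eq] at hxx'
    obtain ⟨h2, h, hh⟩ := htσ _ ((hsat _ _).1 hx)
    have := (hσt _ h2 (h * ⟨_, hxx'⟩)).2
    rw [Subgroup.coe_mul, ← mul_assoc, ← hh] at this
    simpa [mul_assoc] using this.symm

end Slice

end HiggsBundle

/-! ### Principal bundles and existence of associated bundles -/

namespace HiggsBundle

open Set Filter Topology

section AssocTopology

variable {K P F : Type*} [Group K] [MulAction Kᵐᵒᵖ P] [MulAction K F]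

theorem Assoc.mk_eq_iff {p p' : P} {v v' : F} :
    Assoc.mk K p v = Assoc.mk K p' v' ↔ ∃ g : K, p' = p <• g ∧ v' = g⁻¹ • v := by
  refine Quotient.eq.trans ⟨?_, ?_⟩
  · rintro ⟨g, hg⟩
    exact ⟨g, congrArg Prod.fst hg, congrArg Prod.snd hg⟩
  · rintro ⟨g, h1, h2⟩
    exact ⟨g, Prod.ext h1 h2⟩

theorem Assoc.mk_act (p : P) (g : K) (v : F) : Assoc.mk K (p <• g) v = Assoc.mk K p (g • v) :=
  (Assoc.mk_eq_iff.2 ⟨g, rfl, by rw [inv_smul_smul]⟩).symm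

/-- The saturation of an open set is the union of its translates under the diagonal action. -/
theorem isOpenQuotientMap_assoc [TopologicalSpace P] [TopologicalSpace F]
    (hP : ∀ g : K, Continuous fun p : P => p <• g) (hF : ∀ g : K, Continuous fun v : F => g • v) :
    IsOpenQuotientMap fun z : P × F => Assoc.mk K z.1 z.2 := by
  have hqm : IsQuotientMap fun z : P × F => Assoc.mk K z.1 z.2 := isQuotientMap_quot_mk
  refine ⟨hqm.surjective, hqm.continuous, fun O hO => ?_⟩
  rw [← hqm.isOpen_preimage]
  have : (fun z : P × F => Assoc.mk K z.1 z.2) ⁻¹' ((fun z : P × F => Assoc.mk K z.1 z.2) '' O) =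
      ⋃ g : K, (fun z : P × F => (z.1 <• g, g⁻¹ • z.2)) ⁻¹' O := by
    refine Set.ext fun z => ?_
    simp only [mem_preimage, mem_image, mem_iUnion]
    constructor
    · rintro ⟨w, hw, hwz⟩
      obtain ⟨g, h1, h2⟩ := Assoc.mk_eq_iff.1 hwz.symm
      exact ⟨g, by rwa [← h1, ← h2]⟩
    · rintro ⟨g, hg⟩
      exact ⟨_, hg, (Assoc.mk_eq_iff.2 ⟨g, rfl, rfl⟩).symm⟩
  rw [this]
  exact isOpen_iUnion fun g => hO.preimage
    (((hP g).comp continuous_fst).prodMk ((hF g⁻¹).comp continuous_snd))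

end AssocTopology

section Principal

variable {dK dP dB dF : ℕ} {K P B F : Type*} [Group K]
  [TopologicalSpace K] [ChartedSpace (EuclideanSpace ℝ (Fin dK)) K]
  [TopologicalSpace P] [ChartedSpace (EuclideanSpace ℝ (Fin dP)) P]
  [TopologicalSpace B] [ChartedSpace (EuclideanSpace ℝ (Fin dB)) B]
  [MulAction Kᵐᵒᵖ P] {π : P → B}

/-- Around every point of the base, a principal bundle has an equivariant smooth map to the
structure group and a smooth section. -/
theorem IsPrincipalBundle.exists_local
    (hπ : IsPrincipalBundle (dK := dK) (dP := dP) (dB := dB) K π) (b : B) :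
    ∃ (U : Set B) (τ : P → K) (z : B → P), IsOpen U ∧ b ∈ U ∧ IsOpen (π ⁻¹' U) ∧
      ContMDiffOn (𝓡 dP) (𝓡 dB) ∞ π (π ⁻¹' U) ∧
      ContMDiffOn (𝓡 dP) (𝓡 dK) ∞ τ (π ⁻¹' U) ∧ ContMDiffOn (𝓡 dB) (𝓡 dP) ∞ z U ∧
      (∀ p, π p ∈ U → ∀ g : K, τ (p <• g) = τ p * g) ∧
      (∀ p p', π p ∈ U → π p = π p' → τ p = τ p' → p = p') ∧
      (∀ x ∈ U, π (z x) = x) ∧ ∀ x ∈ U, τ (z x) = 1 := by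
  obtain ⟨e, hb, hs, he⟩ := hπ.local_triv b
  have hsrc := e.source_eq
  have hfst : ∀ p, π p ∈ e.baseSet → (e p).1 = π p := fun p hp =>
    e.proj_toFun p (by rw [hsrc]; exact hp)
  have hsmooth := hs.smooth
  rw [hsrc] at hsmooth
  have hmem : ∀ x ∈ e.baseSet, (x, (1 : K)) ∈ e.target := fun x hx => by
    rw [e.target_eq]; exact ⟨hx, mem_univ _⟩
  have hzs : ∀ x ∈ e.baseSet, e.toOpenPartialHomeomorph.symm (x, 1) ∈ e.source := fun x hx =>
    e.map_target (hmem x hx)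
  have hez : ∀ x ∈ e.baseSet, e (e.toOpenPartialHomeomorph.symm (x, 1)) = (x, 1) := fun x hx =>
    e.right_inv (hmem x hx)
  refine ⟨e.baseSet, fun p => (e p).2, fun x => e.toOpenPartialHomeomorph.symm (x, 1),
    e.open_baseSet, hb, by rw [← hsrc]; exact e.open_source, ?_, ?_, ?_, ?_, ?_, ?_, ?_⟩
  · exact (contMDiff_fst.comp_contMDiffOn hsmooth).congr fun p hp => (hfst p hp).symm
  · exact contMDiff_snd.comp_contMDiffOn hsmooth
  · exact hs.smooth_symm.comp (contMDiff_id.prodMk contMDiff_const).contMDiffOn hmem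
  · intro p hp g
    simp only [he p (by rw [hsrc]; exact hp)]
  · intro p p' hp hpp hττ
    refine e.injOn (by rw [hsrc]; exact hp) (by rw [hsrc, mem_preimage, ← hpp]; exact hp) ?_
    refine Prod.ext ?_ hττ
    change (e p).1 = (e p').1
    rw [hfst p hp, hfst p' (hpp ▸ hp), hpp]
  · intro x hx
    rw [← hfst _ (by have := hzs x hx; rwa [hsrc] at this), hez x hx]
  · intro x hx
    simp only
    rw [hez x hx]

theorem IsPrincipalBundle.isSmoothQuotient
    (hπ : IsPrincipalBundle (dK := dK) (dP := dP) (dB := dB) K π) :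
    IsSmoothQuotient (𝓡 dP) (𝓡 dB) π where
  contMDiff p := by
    obtain ⟨U, τ, z, -, hp, hU, h, -⟩ := hπ.exists_local (π p)
    exact h.contMDiffAt (hU.mem_nhds hp)
  exists_section b := by
    obtain ⟨U, τ, z, hU, hb, -, -, -, hz, -, -, hπz, -⟩ := hπ.exists_local b
    exact ⟨U, hU, hb, z, hz, hπz⟩

theorem IsPrincipalBundle.exists_eq_act
    (hπ : IsPrincipalBundle (dK := dK) (dP := dP) (dB := dB) K π) {p p' : P} (h : π p = π p') :
    ∃ g : K, p' = p <• g := by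
  obtain ⟨U, τ, z, -, hp, -, -, -, -, hτ, hinj, -⟩ := hπ.exists_local (π p)
  refine ⟨(τ p)⁻¹ * τ p', (hinj _ _ (by rwa [hπ.proj_act]) (by rw [hπ.proj_act, h]) ?_).symm⟩
  rw [hτ p hp, mul_inv_cancel_left]

theorem IsPrincipalBundle.act_injective
    (hπ : IsPrincipalBundle (dK := dK) (dP := dP) (dB := dB) K π) {p : P} {g g' : K}
    (h : p <• g = p <• g') : g = g' := by
  obtain ⟨U, τ, z, -, hp, -, -, -, -, hτ, -⟩ := hπ.exists_local (π p)
  have := congrArg τ h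
  rw [hτ p hp, hτ p hp] at this
  exact mul_left_cancel this

theorem IsPrincipalBundle.continuous_act
    (hπ : IsPrincipalBundle (dK := dK) (dP := dP) (dB := dB) K π) (g : K) :
    Continuous fun p : P => p <• g :=
  hπ.smooth_act.continuous.comp (continuous_id.prodMk continuous_const)

/-- The coordinate in the structure group defined by a smooth local section. -/
theorem IsPrincipalBundle.exists_coord [LieGroup (𝓡 dK) ∞ K]
    (hπ : IsPrincipalBundle (dK := dK) (dP := dP) (dB := dB) K π) {U : Set B} {z : B → P}
    (hU : IsOpen U) (hz : ContMDiffOn (𝓡 dB) (𝓡 dP) ∞ z U) (hπz : ∀ x ∈ U, π (z x) = x) :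
    ∃ k : P → K, ContMDiffOn (𝓡 dP) (𝓡 dK) ∞ k (π ⁻¹' U) ∧
      (∀ p, π p ∈ U → p = z (π p) <• k p) ∧
      (∀ p, π p ∈ U → ∀ g : K, k (p <• g) = k p * g) ∧ ∀ x ∈ U, k (z x) = 1 := by
  have hex : ∀ p, ∃ g : K, π p ∈ U → p = z (π p) <• g := fun p => by
    by_cases hp : π p ∈ U
    · obtain ⟨g, hg⟩ := hπ.exists_eq_act (hπz _ hp)
      exact ⟨g, fun _ => hg⟩
    · exact ⟨1, fun h => absurd h hp⟩
  choose k hk using hex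
  have hcont := hπ.isSmoothQuotient.contMDiff
  refine ⟨k, ?_, hk, ?_, ?_⟩
  · intro p hp
    obtain ⟨V, τ, -, hV, hpV, hV', -, hτs, -, hτ, -⟩ := hπ.exists_local (π p)
    have hopen : IsOpen (π ⁻¹' (U ∩ V)) := (hU.inter hV).preimage hcont.continuous
    -- Equivariance of `τ` applied to `p = z (π p) <• k p` gives this formula for `k`.
    have h1 : ContMDiffOn (𝓡 dP) (𝓡 dK) ∞ (fun p => (τ (z (π p)))⁻¹ * τ p) (π ⁻¹' (U ∩ V)) := by
      refine ContMDiffOn.mul (ContMDiffOn.inv ?_) (hτs.mono fun p hp => hp.2)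
      refine hτs.comp (hz.comp hcont.contMDiffOn fun p hp => hp.1) fun p hp => ?_
      rw [mem_preimage, mem_preimage, hπz _ hp.1]
      exact hp.2
    have h2 := h1.congr (f₁ := k) fun q hq => by
      have e1 : τ q = τ (z (π q)) * k q := by
        conv_lhs => rw [hk q hq.1]
        exact hτ _ (by rw [hπz _ hq.1]; exact hq.2) _
      simp only [e1, inv_mul_cancel_left]
    exact (h2.contMDiffAt (hopen.mem_nhds ⟨hp, hpV⟩)).contMDiffWithinAt
  · intro p hp g
    refine hπ.act_injective (p := z (π p)) ?_
    have h1 := hk (p <• g) (by rwa [hπ.proj_act])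
    rw [hπ.proj_act] at h1
    rw [← h1, MulOpposite.op_mul, mul_smul, ← hk p hp]
  · intro x hx
    refine hπ.act_injective (p := z x) ?_
    have h1 := hk (z x) (by rwa [hπz x hx])
    rw [hπz x hx] at h1
    rw [← h1, MulOpposite.op_one, one_smul]

section Associated

variable [TopologicalSpace F] [ChartedSpace (EuclideanSpace ℝ (Fin dF)) F] [MulAction K F]

/-- A section `z` writes each `p` over `U` as `z (π p) <• k p`, so every class over `U` has a unique
representative based on `z`. Its fibre coordinate `k p • v` is invariant because `k` is equivariant.
-/
theorem IsPrincipalBundle.exists_localSlice_assoc [LieGroup (𝓡 dK) ∞ K]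
    (hπ : IsPrincipalBundle (dK := dK) (dP := dP) (dB := dB) K π)
    (hF : ContMDiff ((𝓡 dK).prod (𝓡 dF)) (𝓡 dF) ∞ fun q : K × F => q.1 • q.2)
    (hq : IsOpenQuotientMap fun z : P × F => Assoc.mk K z.1 z.2)
    {U : Set B} {z : B → P}
    (hU : IsOpen U) (hz : ContMDiffOn (𝓡 dB) (𝓡 dP) ∞ z U) (hπz : ∀ x ∈ U, π (z x) = x) :
    ∃ t : P × F → B × F, (∀ w, (t w).1 = π w.1) ∧
      LocalSlice ((𝓡 dP).prod (𝓡 dF)) ((𝓡 dB).prod (𝓡 dF))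
        (fun z : P × F => Assoc.mk K z.1 z.2) (Assoc.proj (F := F) π hπ.proj_act ⁻¹' U)
        (U ×ˢ univ) t (fun y => (z y.1, y.2)) := by
  obtain ⟨k, hks, hk, hkg, hkz⟩ := hπ.exists_coord hU hz hπz
  have hcont := hπ.isSmoothQuotient.contMDiff
  refine ⟨fun w => (π w.1, k w.1 • w.2), fun w => rfl, ⟨?_, hU.prod isOpen_univ, ?_, ?_, ?_, ?_, ?_⟩⟩
  · rw [← hq.isQuotientMap.isOpen_preimage]
    exact hU.preimage (hcont.continuous.comp continuous_fst)
  · refine (hcont.comp contMDiff_fst).contMDiffOn.prodMk ?_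
    refine hF.comp_contMDiffOn (ContMDiffOn.prodMk ?_ contMDiff_snd.contMDiffOn)
    exact hks.comp contMDiff_fst.contMDiffOn fun w hw => hw
  · exact (hz.comp contMDiff_fst.contMDiffOn fun y hy => hy.1).prodMk contMDiff_snd.contMDiffOn
  · rintro ⟨x, v⟩ ⟨hx, -⟩
    have h1 : π (z x) = x := hπz x hx
    refine ⟨?_, ?_⟩
    · change π (z x) ∈ U
      rwa [h1]
    · simp only [h1, hkz x hx, one_smul]
  · rintro ⟨p, v⟩ hp
    change π p ∈ U at hp
    refine ⟨⟨hp, mem_univ _⟩, ?_⟩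
    change Assoc.mk K (z (π p)) (k p • v) = Assoc.mk K p v
    rw [← Assoc.mk_act, ← hk p hp]
  · rintro ⟨p, v⟩ ⟨p', v'⟩ hp heq
    change π p ∈ U at hp
    obtain ⟨g, rfl, rfl⟩ := Assoc.mk_eq_iff.1 heq
    simp only [hπ.proj_act, hkg p hp, mul_smul, smul_inv_smul]

/-- Existence of associated bundles. -/
theorem IsPrincipalBundle.exists_isAssociatedBundle [LieGroup (𝓡 dK) ∞ K]
    (hπ : IsPrincipalBundle (dK := dK) (dP := dP) (dB := dB) K π)
    (hP : IsSmoothMfd dP P) (hB : IsSmoothMfd dB B) (hFm : IsSmoothMfd dF F)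
    (hF : ContMDiff ((𝓡 dK).prod (𝓡 dF)) (𝓡 dF) ∞ fun q : K × F => q.1 • q.2) :
    ∃ _ : ChartedSpace (EuclideanSpace ℝ (Fin (dB + dF))) (Assoc K P F),
      IsAssociatedBundle (dP := dP) (dB := dB) (dF := dF) (dY := dB + dF) F π hπ.proj_act ∧
      IsSmoothQuotient ((𝓡 dP).prod (𝓡 dF)) (𝓡 (dB + dF))
        (fun z : P × F => Assoc.mk K z.1 z.2) := by
  have := hP.secondCountable
  have := hFm.secondCountable
  have := hB.t2
  have := hFm.t2
  have := hB.isManifold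
  have := hFm.isManifold
  have hq : IsOpenQuotientMap fun z : P × F => Assoc.mk K z.1 z.2 :=
    isOpenQuotientMap_assoc hπ.continuous_act fun g =>
      hF.continuous.comp (continuous_const.prodMk continuous_id)
  have L : (EuclideanSpace ℝ (Fin dB) × EuclideanSpace ℝ (Fin dF)) ≃L[ℝ]
      EuclideanSpace ℝ (Fin (dB + dF)) := ContinuousLinearEquiv.ofFinrankEq (by simp)
  obtain ⟨cs, hmf, hsq⟩ := exists_isSmoothQuotient (I := (𝓡 dP).prod (𝓡 dF))
    (J := (𝓡 dB).prod (𝓡 dF)) (N := B × F) L hq fun y => by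
      obtain ⟨U, hU, hy, z, hz, hπz⟩ :=
        hπ.isSmoothQuotient.exists_section (Assoc.proj (F := F) π hπ.proj_act y)
      obtain ⟨t, -, ht⟩ := hπ.exists_localSlice_assoc hF hq hU hz hπz
      exact ⟨_, _, _, _, hy, ht⟩
  -- The atlas uses selected sections only, but every smooth section gives a smooth trivialization,
  -- since smoothness is tested through the quotient map from `P × F`.
  have htriv : ∀ (U : Set B) (z : B → P), IsOpen U → ContMDiffOn (𝓡 dB) (𝓡 dP) ∞ z U →
      (∀ x ∈ U, π (z x) = x) →
      ∃ e : Bundle.Trivialization F (Assoc.proj (F := F) π hπ.proj_act), e.baseSet = U ∧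
        IsSmoothTriv (dY := dB + dF) (dB := dB) (dF := dF) e ∧
        ∀ x ∈ U, ∀ v : F, e (Assoc.mk K (z x) v) = (x, v) := by
    intro U z hU hz hπz
    obtain ⟨t, htπ, ht⟩ := hπ.exists_localSlice_assoc hF hq hU hz hπz
    have happ := fun (w : P × F) hw => ht.homeomorph_apply hq (x := w) hw
    let e : Bundle.Trivialization F (Assoc.proj (F := F) π hπ.proj_act) :=
      { toOpenPartialHomeomorph := ht.homeomorph hq
        baseSet := U
        open_baseSet := hU
        source_eq := rfl
        target_eq := rfl
        proj_toFun := fun y hy => by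
          obtain ⟨w, rfl⟩ := hq.surjective y
          rw [happ w hy, htπ w]
          rfl }
    refine ⟨e, rfl, ⟨?_, ?_⟩, fun x hx v => ?_⟩
    · exact hsq.contMDiffOn_of_comp ht.isOpen_base (ht.smooth.congr fun w hw => happ w hw)
    · exact hsq.contMDiff.comp_contMDiffOn ht.smooth_inv
    · have h1 := ht.right_inv (x, v) ⟨hx, mem_univ _⟩
      exact (happ (z x, v) h1.1).trans h1.2
  refine ⟨cs, ⟨⟨hmf, ?_, hq.isQuotientMap.secondCountableTopology hq.isOpenMap⟩, htriv⟩, hsq⟩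
  have hproj : Continuous (Assoc.proj (F := F) π hπ.proj_act) :=
    (hsq.contMDiff_of_comp (I' := 𝓡 dB)
      (hπ.isSmoothQuotient.contMDiff.comp contMDiff_fst)).continuous
  refine t2Space_of_locally_injective (F := B × F) hproj fun b => ?_
  obtain ⟨U, hU, hb, z, hz, hπz⟩ := hπ.isSmoothQuotient.exists_section b
  obtain ⟨e, rfl, -⟩ := htriv U z hU hz hπz
  refine ⟨e.baseSet, hU, hb, e, ?_, ?_⟩
  · rw [← e.source_eq]; exact e.toOpenPartialHomeomorph.continuousOn
  · rw [← e.source_eq]; exact e.toOpenPartialHomeomorph.injOn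

end Associated

end Principal

end HiggsBundle

/-! ### Quotients of principal bundles by the subgroup -/

namespace HiggsBundle

open Set Filter Topology

theorem toSig_eq_iff {G P : Type*} [Group G] (H : Subgroup G) [MulAction Gᵐᵒᵖ P] {p p' : P} :
    toSig H p = toSig H p' ↔ ∃ h : H, p' = p <• h := by
  refine eq_comm.trans (Quotient.eq.trans ⟨?_, ?_⟩)
  · rintro ⟨h, hh⟩
    exact ⟨h.unop, hh.symm⟩
  · rintro ⟨h, hh⟩
    exact ⟨MulOpposite.op h, hh.symm⟩

section Reduction

variable {dG dH dP dS dX dQ dV : ℕ} {G P S X V : Type*} [Group G] [TopologicalSpace G]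
  [ChartedSpace (EuclideanSpace ℝ (Fin dG)) G]
  [TopologicalSpace P] [ChartedSpace (EuclideanSpace ℝ (Fin dP)) P]
  [TopologicalSpace S] [ChartedSpace (EuclideanSpace ℝ (Fin dS)) S]
  [TopologicalSpace X] [ChartedSpace (EuclideanSpace ℝ (Fin dX)) X]
  (H : Subgroup G) [ChartedSpace (EuclideanSpace ℝ (Fin dH)) H]

/-- A smooth quotient by a right action of an embedded subgroup `H` of `G` is a principal bundle
if there are local smooth `H`-equivariant maps to `G`. -/
theorem isPrincipalBundle_of_equivariant [LieGroup (𝓡 dG) ∞ G]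
    (hH : IsEmbeddedLieSubgroup (dG := dG) H dH)
    [MulAction (↥H)ᵐᵒᵖ P] {q : P → S} (hq : IsSmoothQuotient (𝓡 dP) (𝓡 dS) q)
    (hact : ContMDiff ((𝓡 dP).prod (𝓡 dH)) (𝓡 dP) ∞ fun w : P × H => w.1 <• w.2)
    (hinv : ∀ (p : P) (h : H), q (p <• h) = q p)
    (htrans : ∀ p p', q p = q p' → ∃ h : H, p' = p <• h)
    (hτ : ∀ s, ∃ U : Set S, IsOpen U ∧ s ∈ U ∧ ∃ τ : P → G,
      ContMDiffOn (𝓡 dP) (𝓡 dG) ∞ τ (q ⁻¹' U) ∧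
      ∀ p, q p ∈ U → ∀ h : H, τ (p <• h) = τ p * h) :
    IsPrincipalBundle (dK := dH) (dP := dP) (dB := dS) H q where
  smooth_act := hact
  proj_act := hinv
  local_triv s := by
    obtain ⟨U₁, hU₁, hs₁, τ, hτs, hτh⟩ := hτ s
    obtain ⟨U₂, hU₂, hs₂, z, hz, hqz⟩ := hq.exists_section s
    set U := U₁ ∩ U₂
    have hU : IsOpen U := hU₁.inter hU₂
    have hV : IsOpen (q ⁻¹' U) := hU.preimage hq.contMDiff.continuous
    have hex : ∀ p, ∃ h : H, q p ∈ U → p = z (q p) <• h := fun p => by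
      by_cases hp : q p ∈ U
      · obtain ⟨g, hg⟩ := htrans (z (q p)) p (hqz _ hp.2)
        exact ⟨g, fun _ => hg⟩
      · exact ⟨1, fun h => absurd h hp⟩
    choose η hη using hex
    -- The `H`-coordinate relative to `z` is expressed by the smooth `G`-valued `τ`; embeddedness of
    -- `H` then makes it smooth as a map to `H`.
    have hηval : ∀ p, q p ∈ U → (η p : G) = (τ (z (q p)))⁻¹ * τ p := by
      intro p hp
      have h1 : τ p = τ (z (q p)) * η p := by
        conv_lhs => rw [hη p hp]
        exact hτh _ (by rw [hqz _ hp.2]; exact hp.1) _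
      rw [h1, inv_mul_cancel_left]
    have hηG : ContMDiffOn (𝓡 dP) (𝓡 dG) ∞ (fun p => (η p : G)) (q ⁻¹' U) := by
      have h1 : ContMDiffOn (𝓡 dP) (𝓡 dG) ∞ (fun p => (τ (z (q p)))⁻¹ * τ p) (q ⁻¹' U) := by
        refine ContMDiffOn.mul (ContMDiffOn.inv ?_) (hτs.mono fun p hp => hp.1)
        refine hτs.comp (hz.comp hq.contMDiff.contMDiffOn fun p hp => hp.2) fun p hp => ?_
        rw [mem_preimage, mem_preimage, hqz _ hp.2]
        exact hp.1
      exact h1.congr hηval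
    have hηs : ContMDiffOn (𝓡 dP) (𝓡 dH) ∞ η (q ⁻¹' U) := by
      intro p hp
      have h1 := hηG.contMDiffAt (hV.mem_nhds hp)
      exact ((ContMDiffAt.iff_comp_isImmersionAt
        (hH.embedding.isImmersion.isImmersionAt (η p))).2
        ⟨hH.embedding.isEmbedding.isInducing.continuousAt_iff.2 h1.continuousAt,
          h1⟩).contMDiffWithinAt
    have hηact : ∀ p, q p ∈ U → ∀ h : H, η (p <• h) = η p * h := by
      intro p hp h
      apply Subtype.ext
      rw [hηval _ (by rwa [hinv]), hinv, hτh p hp.1, Subgroup.coe_mul, hηval p hp, mul_assoc]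
    have hηz : ∀ x ∈ U, η (z x) = 1 := by
      intro x hx
      apply Subtype.ext
      rw [hηval _ (by rwa [hqz x hx.2]), hqz x hx.2, inv_mul_cancel]
      rfl
    have hfwd : ContMDiffOn (𝓡 dP) ((𝓡 dS).prod (𝓡 dH)) ∞ (fun p => (q p, η p)) (q ⁻¹' U) :=
      hq.contMDiff.contMDiffOn.prodMk hηs
    have hbwd : ContMDiffOn ((𝓡 dS).prod (𝓡 dH)) (𝓡 dP) ∞ (fun w : S × H => z w.1 <• w.2)
        (U ×ˢ univ) :=
      hact.comp_contMDiffOn ((hz.comp contMDiff_fst.contMDiffOn fun w hw => hw.1.2).prodMk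
        contMDiff_snd.contMDiffOn)
    let e : Bundle.Trivialization H q :=
      { toFun := fun p => (q p, η p)
        invFun := fun w => z w.1 <• w.2
        source := q ⁻¹' U
        target := U ×ˢ univ
        map_source' := fun p hp => ⟨hp, mem_univ _⟩
        map_target' := fun w hw => by
          rw [mem_preimage, hinv, hqz _ hw.1.2]; exact hw.1
        left_inv' := fun p hp => (hη p hp).symm
        right_inv' := fun w hw => by
          have h1 : q (z w.1) = w.1 := hqz _ hw.1.2
          rw [hinv, h1, hηact _ (by rw [h1]; exact hw.1), hηz _ hw.1, one_mul]
        open_source := hV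
        open_target := hU.prod isOpen_univ
        continuousOn_toFun := hfwd.continuousOn
        continuousOn_invFun := hbwd.continuousOn
        baseSet := U
        open_baseSet := hU
        source_eq := rfl
        target_eq := rfl
        proj_toFun := fun p hp => rfl }
    refine ⟨e, ⟨hs₁, hs₂⟩, ⟨hfwd, hbwd⟩, fun p hp g => ?_⟩
    exact Prod.ext (hinv p g) (hηact p hp g)

/-- Lying in the same coset is a closed relation, being the preimage of `H` under `(g, g') ↦ g⁻¹ *
g'`. -/
theorem t2Space_quotient [IsTopologicalGroup G] (hH : IsClosed (H : Set G)) : T2Space (G ⧸ H) := by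
  rw [t2Space_iff_of_isOpenQuotientMap QuotientGroup.isOpenQuotientMap_mk]
  have : {w : G × G | (QuotientGroup.mk w.1 : G ⧸ H) = QuotientGroup.mk w.2} =
      (fun w : G × G => w.1⁻¹ * w.2) ⁻¹' H := by
    refine Set.ext fun w => ?_
    exact QuotientGroup.eq
  rw [this]
  exact hH.preimage (by fun_prop)

section Sigma

variable [MulAction Gᵐᵒᵖ P] {π : P → X}

theorem isOpenQuotientMap_toSig
    (hπ : IsPrincipalBundle (dK := dG) (dP := dP) (dB := dX) G π) :
    IsOpenQuotientMap (toSig H : P → Sig H P) := by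
  have : ContinuousConstSMul (↥H)ᵐᵒᵖ P := ⟨fun h => hπ.continuous_act (h.unop : G)⟩
  exact MulAction.isOpenQuotientMap_quotientMk

/-- The quotient of a principal `G`-bundle by an embedded subgroup `H` is a manifold, locally
the product of the base and `G ⧸ H`. -/
theorem IsPrincipalBundle.exists_isSmoothQuotient_toSig
    (hπ : IsPrincipalBundle (dK := dG) (dP := dP) (dB := dX) G π)
    (hP : IsSmoothMfd dP P) (hX : IsSmoothMfd dX X)
    [ChartedSpace (EuclideanSpace ℝ (Fin dQ)) (G ⧸ H)] (hQ : IsSmoothMfd dQ (G ⧸ H))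
    (hmk : IsSmoothQuotient (𝓡 dG) (𝓡 dQ) (QuotientGroup.mk : G → G ⧸ H)) :
    ∃ _ : ChartedSpace (EuclideanSpace ℝ (Fin (dX + dQ))) (Sig H P),
      IsSmoothMfd (dX + dQ) (Sig H P) ∧
      IsSmoothQuotient (𝓡 dP) (𝓡 (dX + dQ)) (toSig H : P → Sig H P) := by
  have := hP.secondCountable
  have := hX.t2
  have := hQ.t2
  have := hX.isManifold
  have := hQ.isManifold
  have hq : IsOpenQuotientMap (toSig H : P → Sig H P) := isOpenQuotientMap_toSig H hπ
  have hcont := hπ.isSmoothQuotient.contMDiff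
  have L : (EuclideanSpace ℝ (Fin dX) × EuclideanSpace ℝ (Fin dQ)) ≃L[ℝ]
      EuclideanSpace ℝ (Fin (dX + dQ)) := ContinuousLinearEquiv.ofFinrankEq (by simp)
  have hmkτ : ∀ {U : Set X} {τ : P → G}, (∀ p, π p ∈ U → ∀ g : G, τ (p <• g) = τ p * g) →
      ∀ p, π p ∈ U → ∀ h : H,
        (QuotientGroup.mk (τ (p <• h)) : G ⧸ H) = QuotientGroup.mk (τ p) := by
    intro U τ hτ p hp h
    have h1 : τ (p <• h) = τ p * h := hτ p hp h
    rw [h1]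
    exact QuotientGroup.mk_mul_of_mem _ h.2
  obtain ⟨cs, hmf, hsq⟩ := exists_isSmoothQuotient (I := 𝓡 dP) (J := (𝓡 dX).prod (𝓡 dQ))
    (N := X × (G ⧸ H)) L hq fun y => by
      obtain ⟨p₀, rfl⟩ := hq.surjective y
      obtain ⟨U, τ, z, hU, hp₀, hπU, -, hτs, hz, hτ, hinj, hπz, hτz⟩ := hπ.exists_local (π p₀)
      obtain ⟨U', hU', hp₀', ζ, hζ, hmkζ⟩ := hmk.exists_section (QuotientGroup.mk (τ p₀))
      have hmτ : ContMDiffOn (𝓡 dP) (𝓡 dQ) ∞ (fun p => (QuotientGroup.mk (τ p) : G ⧸ H))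
          (π ⁻¹' U) := hmk.contMDiff.comp_contMDiffOn hτs
      set O : Set P := π ⁻¹' U ∩ (fun p => (QuotientGroup.mk (τ p) : G ⧸ H)) ⁻¹' U'
      have hO : IsOpen O := (continuousOn_open_iff hπU).1 hmτ.continuousOn _ hU'
      have hsat : ∀ p, toSig H p ∈ (toSig H : P → Sig H P) '' O → p ∈ O := by
        rintro p ⟨p', ⟨h1, h2⟩, hpp⟩
        obtain ⟨h, rfl⟩ := (toSig_eq_iff H).1 hpp
        have h3 : π (p' <• h) = π p' := hπ.proj_act p' h
        exact ⟨by rw [mem_preimage, h3]; exact h1, by rw [mem_preimage, hmkτ hτ p' h1]; exact h2⟩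
      -- The coordinates of `p` are its base point and the coset of its group coordinate. A local
      -- section `ζ` of `G → G ⧸ H`, combined with the section `z` of `P`, lifts them back.
      refine ⟨toSig H '' O, U ×ˢ U', fun p => (π p, QuotientGroup.mk (τ p)),
        fun w => z w.1 <• ζ w.2, ⟨p₀, ⟨hp₀, hp₀'⟩, rfl⟩,
        ⟨hq.isOpenMap _ hO, hU.prod hU', ?_, ?_, ?_, ?_, ?_⟩⟩
      · exact (hcont.contMDiffOn.prodMk hmτ).mono fun p hp => (hsat p hp).1
      · exact hπ.smooth_act.comp_contMDiffOn
          ((hz.comp contMDiff_fst.contMDiffOn fun w hw => hw.1).prodMk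
            (hζ.comp contMDiff_snd.contMDiffOn fun w hw => hw.2))
      · rintro ⟨x, y⟩ ⟨hx, hy⟩
        have h1 : π (z x <• ζ y) = x := by rw [hπ.proj_act, hπz x hx]
        have h2 : (QuotientGroup.mk (τ (z x <• ζ y)) : G ⧸ H) = y := by
          rw [hτ _ (by rwa [hπz x hx]), hτz x hx, one_mul, hmkζ y hy]
        refine ⟨⟨_, ⟨?_, ?_⟩, rfl⟩, Prod.ext h1 h2⟩
        · rw [mem_preimage, h1]; exact hx
        · rw [mem_preimage, h2]; exact hy
      · intro p hp
        obtain ⟨h1, h2⟩ := hsat p hp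
        refine ⟨⟨h1, h2⟩, (toSig_eq_iff H).2 ?_⟩
        have h3 := QuotientGroup.eq.1 (hmkζ _ h2)
        refine ⟨⟨_, h3⟩, ?_⟩
        change p = (z (π p) <• ζ (QuotientGroup.mk (τ p))) <•
          ((ζ (QuotientGroup.mk (τ p)))⁻¹ * τ p)
        rw [← mul_smul, ← MulOpposite.op_mul, mul_inv_cancel_left]
        have h4 : π (z (π p)) = π p := hπz _ h1
        refine hinj _ _ h1 (by rw [hπ.proj_act, h4]) ?_
        rw [hτ _ (by rw [h4]; exact h1), hτz _ h1, one_mul]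
      · intro p p' hp hpp
        obtain ⟨h1, h2⟩ := hsat p hp
        obtain ⟨h, rfl⟩ := (toSig_eq_iff H).1 hpp
        exact Prod.ext (hπ.proj_act p h).symm (hmkτ hτ p h1 h).symm
  refine ⟨cs, ⟨hmf, ?_, hq.isQuotientMap.secondCountableTopology hq.isOpenMap⟩, hsq⟩
  have hproj : Continuous (sigProj H π hπ.proj_act) :=
    (hsq.contMDiff_of_comp (I' := 𝓡 dX) hcont).continuous
  refine t2Space_of_locally_injective (F := X × (G ⧸ H)) (ϖ := sigProj H π hπ.proj_act) hproj
    fun x => ?_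
  obtain ⟨U, τ, z, hU, hx, hπU, -, hτs, -, hτ, hinj, -⟩ := hπ.exists_local x
  -- These coordinates are injective over all of `U`, which separates points in the same fibre over
  -- `X`.
  let f : Sig H P → X × (G ⧸ H) := fun y =>
    (sigProj H π hπ.proj_act y, QuotientGroup.mk (τ (Function.surjInv hq.surjective y)))
  have hf : ∀ p, π p ∈ U → f (toSig H p) = (π p, QuotientGroup.mk (τ p)) := by
    intro p hp
    have h1 := Function.surjInv_eq hq.surjective (toSig H p)
    obtain ⟨h, hh⟩ := (toSig_eq_iff H).1 h1.symm
    change (π p, QuotientGroup.mk (τ (Function.surjInv hq.surjective (toSig H p)))) = _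
    rw [hh]
    exact Prod.ext rfl (hmkτ hτ p hp h)
  refine ⟨U, hU, hx, f, ?_, ?_⟩
  · refine (hsq.contMDiffOn_of_comp (I' := (𝓡 dX).prod (𝓡 dQ)) (f := f) (hU.preimage hproj)
      ?_).continuousOn
    exact (hcont.contMDiffOn.prodMk (hmk.contMDiff.comp_contMDiffOn hτs)).congr
      fun p hp => hf p hp
  · intro y hy y' hy' hyy
    obtain ⟨p, rfl⟩ := hq.surjective y
    obtain ⟨p', rfl⟩ := hq.surjective y'
    rw [hf p hy, hf p' hy', Prod.mk.injEq] at hyy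
    refine (toSig_eq_iff H).2 ⟨⟨_, QuotientGroup.eq.1 hyy.2⟩, ?_⟩
    change p' = p <• ((τ p)⁻¹ * τ p')
    refine hinj _ _ hy' (by rw [hπ.proj_act, hyy.1]) ?_
    rw [hτ p hy, mul_inv_cancel_left]

end Sigma

end Reduction

end HiggsBundle

/-! ### The induced representation and the composite bundle -/

namespace HiggsBundle

open Set Filter Topology

section Composite

variable {G : Type*} [Group G] (H : Subgroup G) (P V : Type*) [MulAction Gᵐᵒᵖ P] [MulAction H V]

/-- The bijection `(p, (g, v) / H) / G ↦ (p g, v) / H`, with inverse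
`(p, v) / H ↦ (p, (1, v) / H) / G`. -/
def assocEquiv : Assoc G P (Assoc H G V) ≃ Assoc H P V where
  toFun := Quotient.lift
    (fun a : P × Assoc H G V => Quotient.lift (s := assocSetoid H G V)
      (fun b : G × V => Assoc.mk H (a.1 <• b.1) b.2)
      (by
        rintro ⟨g, v⟩ _ ⟨h, rfl⟩
        have h1 : a.1 <• (g * (h : G)) = (a.1 <• g) <• h := mul_smul (MulOpposite.op (h : G)) _ _
        change _ = Assoc.mk H (a.1 <• (g * (h : G))) (h⁻¹ • v)
        rw [h1, Assoc.mk_act, smul_inv_smul]) a.2)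
    (by
      rintro ⟨p, ⟨g, v⟩⟩ _ ⟨k, rfl⟩
      have h1 : (p <• k) <• (k⁻¹ * g) = p <• g := by
        rw [← mul_smul, ← MulOpposite.op_mul, mul_inv_cancel_left]
      change Assoc.mk H (p <• g) v = Assoc.mk H ((p <• k) <• (k⁻¹ * g)) v
      rw [h1])
  invFun := Quotient.lift (fun a : P × V => Assoc.mk G a.1 (Assoc.mk H (1 : G) a.2))
    (by
      rintro ⟨p, v⟩ _ ⟨h, rfl⟩
      change _ = Assoc.mk G (p <• (h : G)) (Assoc.mk H (1 : G) (h⁻¹ • v))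
      have h1 : (h : G) • Assoc.mk H (1 : G) (h⁻¹ • v) = Assoc.mk H ((1 : G) <• h) (h⁻¹ • v) :=
        congrArg (fun g => Assoc.mk H g (h⁻¹ • v)) ((mul_one (h : G)).trans (one_mul _).symm)
      rw [Assoc.mk_act, h1, Assoc.mk_act, smul_inv_smul])
  left_inv := by
    rintro ⟨p, ⟨g, v⟩⟩
    change Assoc.mk G (p <• g) (Assoc.mk H (1 : G) v) = Assoc.mk G p (Assoc.mk H g v)
    rw [Assoc.mk_act]
    exact congrArg (fun g => Assoc.mk G p (Assoc.mk H g v)) (mul_one g)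
  right_inv := by
    rintro ⟨p, v⟩
    change Assoc.mk H (p <• (1 : G)) v = Assoc.mk H p v
    rw [MulOpposite.op_one, one_smul]

end Composite

section Coset

variable {dG dH dP dS dX dQ dV dW dY dZ : ℕ} {G P X V : Type*} [Group G] [TopologicalSpace G]
  [ChartedSpace (EuclideanSpace ℝ (Fin dG)) G]
  [TopologicalSpace P] [ChartedSpace (EuclideanSpace ℝ (Fin dP)) P]
  [TopologicalSpace X] [ChartedSpace (EuclideanSpace ℝ (Fin dX)) X]
  [TopologicalSpace V] [ChartedSpace (EuclideanSpace ℝ (Fin dV)) V]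
  (H : Subgroup G) [ChartedSpace (EuclideanSpace ℝ (Fin dH)) H]

theorem isPrincipalBundle_mk [LieGroup (𝓡 dG) ∞ G]
    (hH : IsEmbeddedLieSubgroup (dG := dG) H dH)
    [ChartedSpace (EuclideanSpace ℝ (Fin dQ)) (G ⧸ H)]
    (hmk : IsSmoothQuotient (𝓡 dG) (𝓡 dQ) (QuotientGroup.mk : G → G ⧸ H)) :
    IsPrincipalBundle (dK := dH) (dP := dG) (dB := dQ) H (QuotientGroup.mk : G → G ⧸ H) := by
  refine isPrincipalBundle_of_equivariant H hH hmk ?_ (coset_act H) ?_ fun s =>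
    ⟨univ, isOpen_univ, mem_univ _, id, contMDiffOn_id, fun p _ h => rfl⟩
  · exact contMDiff_fst.mul (hH.embedding.contMDiff.comp contMDiff_snd)
  · intro p p' hpp
    exact ⟨⟨_, QuotientGroup.eq.1 hpp⟩, (mul_inv_cancel_left p p').symm⟩

variable [MulAction Gᵐᵒᵖ P] {π : P → X}

theorem IsPrincipalBundle.contMDiff_sigProj
    (hπ : IsPrincipalBundle (dK := dG) (dP := dP) (dB := dX) G π)
    [ChartedSpace (EuclideanSpace ℝ (Fin dS)) (Sig H P)]
    (hq : IsSmoothQuotient (𝓡 dP) (𝓡 dS) (toSig H : P → Sig H P)) :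
    ContMDiff (𝓡 dS) (𝓡 dX) ∞ (sigProj H π hπ.proj_act) :=
  hq.contMDiff_of_comp hπ.isSmoothQuotient.contMDiff

/-- The group coordinate of a local trivialization of `P` over `X` is `G`-equivariant, so in
particular it provides the `H`-equivariant maps to `G` that the criterion requires. -/
theorem IsPrincipalBundle.isPrincipalBundle_toSig [LieGroup (𝓡 dG) ∞ G]
    (hπ : IsPrincipalBundle (dK := dG) (dP := dP) (dB := dX) G π)
    (hH : IsEmbeddedLieSubgroup (dG := dG) H dH)
    [ChartedSpace (EuclideanSpace ℝ (Fin dS)) (Sig H P)]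
    (hq : IsSmoothQuotient (𝓡 dP) (𝓡 dS) (toSig H : P → Sig H P)) :
    IsPrincipalBundle (dK := dH) (dP := dP) (dB := dS) H (toSig H : P → Sig H P) := by
  refine isPrincipalBundle_of_equivariant H hH hq ?_ (toSig_act H)
    (fun p p' => (toSig_eq_iff H).1) fun s => ?_
  · exact hπ.smooth_act.comp
      (contMDiff_fst.prodMk (hH.embedding.contMDiff.comp contMDiff_snd))
  · obtain ⟨U, τ, -, hU, hs, -, -, hτs, -, hτ, -⟩ := hπ.exists_local (sigProj H π hπ.proj_act s)
    exact ⟨_, hU.preimage (hπ.contMDiff_sigProj H hq).continuous, hs, τ, hτs,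
      fun p hp h => hτ p hp h⟩

variable [MulAction H V]

/-- The product of the identity of `G` with `G × V → W` is again a smooth quotient, so the action
may be tested on `G × (G × V)`, where it is multiplication in `G`. -/
theorem contMDiff_inducedAction [LieGroup (𝓡 dG) ∞ G]
    [ChartedSpace (EuclideanSpace ℝ (Fin dW)) (Assoc H G V)]
    (hq : IsSmoothQuotient ((𝓡 dG).prod (𝓡 dV)) (𝓡 dW)
      (fun z : G × V => Assoc.mk H z.1 z.2)) :
    ContMDiff ((𝓡 dG).prod (𝓡 dW)) (𝓡 dW) ∞ (fun q : G × Assoc H G V => q.1 • q.2) := by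
  refine (hq.id_prodMap (I' := 𝓡 dG) (M' := G)).contMDiff_of_comp ?_
  exact hq.contMDiff.comp
    ((contMDiff_fst.mul (contMDiff_fst.comp contMDiff_snd)).prodMk
      (contMDiff_snd.comp contMDiff_snd))

/-- The bijection `assocEquiv` is a diffeomorphism. -/
def IsPrincipalBundle.assocDiffeomorph
    (hπ : IsPrincipalBundle (dK := dG) (dP := dP) (dB := dX) G π)
    [ChartedSpace (EuclideanSpace ℝ (Fin dW)) (Assoc H G V)]
    [ChartedSpace (EuclideanSpace ℝ (Fin dY)) (Assoc H P V)]
    [ChartedSpace (EuclideanSpace ℝ (Fin dZ)) (Assoc G P (Assoc H G V))]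
    (hW : IsSmoothQuotient ((𝓡 dG).prod (𝓡 dV)) (𝓡 dW) (fun z : G × V => Assoc.mk H z.1 z.2))
    (hY : IsSmoothQuotient ((𝓡 dP).prod (𝓡 dV)) (𝓡 dY) (fun z : P × V => Assoc.mk H z.1 z.2))
    (hZ : IsSmoothQuotient ((𝓡 dP).prod (𝓡 dW)) (𝓡 dZ)
      (fun z : P × Assoc H G V => Assoc.mk G z.1 z.2)) :
    Diffeomorph (𝓡 dZ) (𝓡 dY) (Assoc G P (Assoc H G V)) (Assoc H P V) ∞ where
  toEquiv := assocEquiv H P V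
  contMDiff_toFun := by
    -- Two quotients are lifted in turn, first that by `G` and then that by `H` inside `W`, leaving
    -- `(p, (g, v)) ↦ (p g, v)/H`.
    refine hZ.contMDiff_of_comp ((hW.id_prodMap (I' := 𝓡 dP) (M' := P)).contMDiff_of_comp ?_)
    exact hY.contMDiff.comp
      ((hπ.smooth_act.comp (contMDiff_fst.prodMk (contMDiff_fst.comp contMDiff_snd))).prodMk
        (contMDiff_snd.comp contMDiff_snd))
  contMDiff_invFun := by
    refine hY.contMDiff_of_comp ?_
    exact hZ.contMDiff.comp
      (contMDiff_fst.prodMk (hW.contMDiff.comp (contMDiff_const.prodMk contMDiff_snd)))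

end Coset

end HiggsBundle

/-! ### Assembly of the theorem -/

open HiggsBundle in
theorem mainTheorem1 {dG dP dX dV : ℕ} {G P X V : Type*}
    -- the Lie group `G`
    [Group G] [TopologicalSpace G] [ChartedSpace (EuclideanSpace ℝ (Fin dG)) G]
    [LieGroup (𝓡 dG) ∞ G] (hG : IsSmoothMfd dG G)
    -- the principal `G`-bundle `π : P → X`
    [TopologicalSpace P] [ChartedSpace (EuclideanSpace ℝ (Fin dP)) P] (hP : IsSmoothMfd dP P)
    [TopologicalSpace X] [ChartedSpace (EuclideanSpace ℝ (Fin dX)) X] (hX : IsSmoothMfd dX X)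
    [MulAction Gᵐᵒᵖ P] (π : P → X)
    (hπ : IsPrincipalBundle (dK := dG) (dP := dP) (dB := dX) G π)
    -- the closed subgroup `H`
    (H : Subgroup G) (hH : IsClosed (H : Set G))
    -- the manifold `V` on which `H` acts on the left
    [TopologicalSpace V] [ChartedSpace (EuclideanSpace ℝ (Fin dV)) V] (hV : IsSmoothMfd dV V)
    [MulAction H V] :
    -- `H` is a Lie group, embedded in `G`,
    (∃ (dH : ℕ) (_ : ChartedSpace (EuclideanSpace ℝ (Fin dH)) H),
      IsEmbeddedLieSubgroup (dG := dG) H dH) ∧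
    -- and, with respect to this Lie group structure, if the action of `H` on `V` is smooth, then
    ∀ (dH : ℕ) [ChartedSpace (EuclideanSpace ℝ (Fin dH)) H],
      IsEmbeddedLieSubgroup (dG := dG) H dH →
      ContMDiff ((𝓡 dH).prod (𝓡 dV)) (𝓡 dV) ∞ (fun q : H × V => q.1 • q.2) →
      -- there are smooth structures on `P / H`, `G / H`, `Y = (P × V) / H`, `W = (G × V) / H`
      -- and `(P × W) / G`,
      ∃ (dS dQ dY dW dZ : ℕ)
        (_ : ChartedSpace (EuclideanSpace ℝ (Fin dS)) (Sig H P))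
        (_ : ChartedSpace (EuclideanSpace ℝ (Fin dQ)) (G ⧸ H))
        (_ : ChartedSpace (EuclideanSpace ℝ (Fin dY)) (Assoc H P V))
        (_ : ChartedSpace (EuclideanSpace ℝ (Fin dW)) (Assoc H G V))
        (_ : ChartedSpace (EuclideanSpace ℝ (Fin dZ)) (Assoc G P (Assoc H G V))),
        -- for which `P → P / H` and `G → G / H` are principal `H`-bundles,
        IsSmoothMfd dS (Sig H P) ∧
        IsPrincipalBundle (dK := dH) (dP := dP) (dB := dS) H (toSig H : P → Sig H P) ∧
        ContMDiff (𝓡 dS) (𝓡 dX) ∞ (sigProj H π hπ.proj_act) ∧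
        IsSmoothMfd dQ (G ⧸ H) ∧
        IsPrincipalBundle (dK := dH) (dP := dG) (dB := dQ) H (QuotientGroup.mk : G → G ⧸ H) ∧
        -- `Y → P / H` and `W → G / H` are the associated bundles with typical fibre `V`,
        IsAssociatedBundle (dP := dP) (dB := dS) (dF := dV) (dY := dY) V
          (toSig H : P → Sig H P) (toSig_act H) ∧
        IsAssociatedBundle (dP := dG) (dB := dQ) (dF := dV) (dY := dW) V
          (QuotientGroup.mk : G → G ⧸ H) (coset_act H) ∧
        -- `G` acts smoothly on `W` by the induced representation,
        (∀ (g' g : G) (v : V), g' • Assoc.mk H g v = Assoc.mk H (g' * g) v) ∧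
        ContMDiff ((𝓡 dG).prod (𝓡 dW)) (𝓡 dW) ∞ (fun q : G × Assoc H G V => q.1 • q.2) ∧
        -- `(P × W) / G → X` is the `P`-associated bundle with typical fibre `W`,
        IsAssociatedBundle (dP := dP) (dB := dX) (dF := dW) (dY := dZ) (Assoc H G V)
          π hπ.proj_act ∧
        -- and it is isomorphic to the composite bundle `Y → P / H → X`.
        ∃ Φ : Diffeomorph (𝓡 dZ) (𝓡 dY) (Assoc G P (Assoc H G V)) (Assoc H P V) ∞,
          (∀ (p : P) (g : G) (v : V),
            Φ (Assoc.mk G p (Assoc.mk H g v)) = Assoc.mk H (p <• g) v) ∧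
          ∀ w : Assoc G P (Assoc H G V),
            sigProj H π hπ.proj_act (Assoc.proj (toSig H) (toSig_act H) (Φ w)) =
              Assoc.proj π hπ.proj_act w := by
  have : IsTopologicalGroup G := topologicalGroup_of_lieGroup (𝓡 dG) ∞
  have := hG.secondCountable
  refine ⟨exists_isEmbeddedLieSubgroup H hH, fun dH _ hemb hact => ?_⟩
  have := hemb.lieGroup
  obtain ⟨dQ, csQ, hQm, hmk⟩ := exists_isSmoothQuotient_mk H hemb
  have hQ : IsSmoothMfd dQ (G ⧸ H) := ⟨hQm, t2Space_quotient H hH,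
    QuotientGroup.isOpenQuotientMap_mk.isQuotientMap.secondCountableTopology
      QuotientGroup.isOpenQuotientMap_mk.isOpenMap⟩
  obtain ⟨csS, hS, hsig⟩ := hπ.exists_isSmoothQuotient_toSig H hP hX hQ hmk
  have hPS := hπ.isPrincipalBundle_toSig H hemb hsig
  have hGQ := isPrincipalBundle_mk H hemb hmk
  obtain ⟨csY, hY, hYq⟩ := hPS.exists_isAssociatedBundle hP hS hV hact
  obtain ⟨csW, hW, hWq⟩ := hGQ.exists_isAssociatedBundle hG hQ hV hact
  have hGW := contMDiff_inducedAction H hWq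
  -- The existence theorem for associated bundles is applied a third time, now with group `G` and
  -- fibre `W`; it needs `W` to be a manifold and the induced action to be smooth.
  obtain ⟨csZ, hZ, hZq⟩ := hπ.exists_isAssociatedBundle hP hX hW.mfd hGW
  refine ⟨_, _, _, _, _, csS, csQ, csY, csW, csZ, hS, hPS, hπ.contMDiff_sigProj H hsig, hQ, hGQ,
    hY, hW, fun _ _ _ => rfl, hGW, hZ, hπ.assocDiffeomorph H hWq hYq hZq, fun _ _ _ => rfl, ?_⟩
  rintro ⟨p, ⟨g, v⟩⟩
  exact hπ.proj_act p g
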